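/- Let $V=\Lambda\otimes\mathbb R$ be a finite-dimensional real vector space with lattice $\Lambda$. For a polyhedron $\sigma\subseteq V$ let $V_\sigma$ be the linear space spanned by the differences of points of $\sigma$, and $\Lambda_\sigma=\Lambda\cap V_\sigma$. A \emph{cycle} $X$ in $V$ is a finite, pure-dimensional, rational polyhedral complex with integer weights $\omega_X(\sigma)$ on its top-dimensional polyhedra (facets), such that at every polyhedron $\tau$ of codimension one (ridge) $\sum_{\sigma>\tau}\omega_X(\sigma)v_{\sigma/\tau}\in V_\tau$, the sum running over the facets $\sigma$ containing $\tau$; here $v_{\sigma/\tau}\in\Lambda$ is a primitive vector, i.e. it points from $\tau$ towards $\sigma$ and $\mathbb Z v_{\sigma/\tau}+\Lambda_\tau=\Lambda_\sigma$. A \emph{rational function} $\varphi$ on $X$ is a real function on the union of the polyhedra of $X$ whose restriction to each polyhedron $\sigma\in X$ is the sum of a real constant and (the restriction of) a linear form whose restriction $\varphi_\sigma$ to $V_\sigma$ is integral on $\Lambda_\sigma$. The \emph{divisor} $\varphi\cdot X$ is the complex of all polyhedra of $X$ that are not facets, with the weights $$\omega_{\varphi\cdot X}(\tau)=\sum_{\sigma>\tau}\omega_X(\sigma)\,\varphi_\sigma(v_{\sigma/\tau})-\varphi_\tau\Big(\sum_{\sigma>\tau}\omega_X(\sigma)\,v_{\sigma/\tau}\Big)$$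 on the ridges $\tau$ of $X$, and $\varphi_1\cdots\varphi_l\cdot X$ is the iterated divisor $\varphi_1\cdot(\varphi_2\cdots(\varphi_l\cdot X))$. For $\tau\in X$ let $\mathrm{Star}_X(\tau)$ be the fan in $V/V_\tau$ (with the image of $\Lambda$ as lattice) of the cones $\bar\sigma$ spanned by the images of $\sigma-\tau$, for all $\sigma\in X$ having $\tau$ as a face ($\sigma=\tau$ included), with weights $\omega(\bar\sigma)=\omega_X(\sigma)$ on the facets. A \emph{germ} $\varphi^\tau$ of a rational function $\varphi$ on $X$ is the function induced by $\varphi-\psi$ on $\mathrm{Star}_X(\tau)$, i.e. $\varphi^\tau(t[x-y])=t(\varphi-\psi)(x)$ for $x\in\sigma$, $y\in\tau$, $t\ge 0$, where $\psi$ is any affine function on $V$ with $\psi|_\tau=\varphi|_\tau$. Let $X$ be a cycle, let $\tau,\sigma\in X$ be polyhedra such that $\tau$ is a face of $\sigma$, and let $\varphi,\varphi_1,\dots,\varphi_l$ ($l\ge 0$) be rational functions on $X$. Then the image of $\Lambda$ in $V/V_\tau$ is a lattice, $\mathrm{Star}_X(\tau)$ is a cycle and a fan, $\varphi$ has a germ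 at $\tau$ that is a rational function on $\mathrm{Star}_X(\tau)$, $\varphi_1\cdots\varphi_l\cdot X$ is a cycle, and, for all choices of the germs: (a) $\mathrm{Star}_{\mathrm{Star}_X(\tau)}(\bar\sigma)=\mathrm{Star}_X(\sigma)$ under the canonical isomorphism $(V/V_\tau)/V_{\bar\sigma}\cong V/V_\sigma$, which identifies the lattices; (b) under the same identification, $(\varphi^\tau)^{\bar\sigma}=\varphi^\sigma$ on $\mathrm{Star}_X(\sigma)$ up to adding a linear function; (c) $\mathrm{Star}_{\varphi\cdot X}(\tau)=\varphi^\tau\cdot\mathrm{Star}_X(\tau)$, where the left hand side is the empty complex if $\tau$ is a facet of $X$; (d) $\mathrm{Star}_{\varphi_1\cdots\varphi_l\cdot X}(\tau)=\varphi_1^\tau\cdots\varphi_l^\tau\cdot\mathrm{Star}_X(\tau)$, where the left hand side is again the empty complex if $\tau$ is not a polyhedron of $\varphi_1\cdots\varphi_l\cdot X$; (e) if $l=\dim X-\dim\tau$, then $\omega_{\varphi_1\cdots\varphi_l\cdot X}(\tau)=\omega_{\varphi_1^\tau\cdots\varphi_l^\tau\cdot\mathrm{Star}_X(\tau)}(\{0\})$.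 -/

import Mathlib

namespace TropicalCycle

noncomputable section

/-- `Λ` is a full lattice in `V`: it is spanned over `ℤ` by an `ℝ`-basis of `V`,
i.e. `V = Λ ⊗ ℝ`. -/
def IsLattice {V : Type*} [AddCommGroup V] [Module ℝ V] (Λ : Submodule ℤ V) : Prop :=
  ∃ b : Module.Basis (Fin (Module.finrank ℝ V)) ℝ V, Λ = Submodule.span ℤ (Set.range b)

/-- A rational polyhedron: a finite intersection of half spaces `{x | c ≤ f x}` with `f` an
integer linear form and `c` a real number. -/
def IsRationalPolyhedron {V : Type*} [AddCommGroup V] [Module ℝ V] (Λ : Submodule ℤ V)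
    (σ : Set V) : Prop :=
  ∃ s : Finset ((V →ₗ[ℝ] ℝ) × ℝ),
    (∀ p ∈ s, ∀ v ∈ Λ, ∃ n : ℤ, p.1 v = n) ∧ σ = {x | ∀ p ∈ s, p.2 ≤ p.1 x}

/-- `τ` is a (non-empty) face of the polyhedron `σ`: the locus in `σ` where some linear form is
minimal. In particular `σ` is a face of itself. -/
def IsFace {V : Type*} [AddCommGroup V] [Module ℝ V] (τ σ : Set V) : Prop :=
  τ.Nonempty ∧ ∃ f : V →ₗ[ℝ] ℝ, τ = {x | x ∈ σ ∧ ∀ y ∈ σ, f x ≤ f y}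

/-- The dimension of a polyhedron. The linear space `V_σ` belonging to `σ` is
`vectorSpan ℝ σ`, the span of all differences of points of `σ`. -/
def polyDim {V : Type*} [AddCommGroup V] [Module ℝ V] (σ : Set V) : ℕ :=
  Module.finrank ℝ (vectorSpan ℝ σ)

/-- The lattice `Λ_σ = Λ ∩ V_σ`. -/
def latticeOf {V : Type*} [AddCommGroup V] [Module ℝ V] (Λ : Submodule ℤ V) (σ : Set V) :
    Submodule ℤ V :=
  Λ ⊓ (vectorSpan ℝ σ).restrictScalars ℤ

/-- The lattice of the quotient space `V / V_τ`, the image of `Λ`. -/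
def quotLattice {V : Type*} [AddCommGroup V] [Module ℝ V] (Λ : Submodule ℤ V) (τ : Set V) :
    Submodule ℤ (V ⧸ vectorSpan ℝ τ) :=
  Λ.map ((vectorSpan ℝ τ).mkQ.restrictScalars ℤ)

/-- The cone `σ̄` in `V / V_τ` spanned by the image of `σ - τ`. (For convex `τ ⊆ σ` this image is
convex and contains `0`, so that the cone spanned by it consists of its non-negative multiples.) -/
def starCone {V : Type*} [AddCommGroup V] [Module ℝ V] (τ σ : Set V) :
    Set (V ⧸ vectorSpan ℝ τ) :=
  {p | ∃ t : ℝ, 0 ≤ t ∧ ∃ x ∈ σ, ∃ y ∈ τ, p = t • (vectorSpan ℝ τ).mkQ (x - y)}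

/-- `v` is a primitive vector of `σ` modulo `τ`: a lattice vector that points from `τ` towards `σ`
and satisfies `ℤ v + Λ_τ = Λ_σ`. -/
def IsPrimitive {V : Type*} [AddCommGroup V] [Module ℝ V] (Λ : Submodule ℤ V) (τ σ : Set V)
    (v : V) : Prop :=
  v ∈ Λ ∧ (vectorSpan ℝ τ).mkQ v ∈ starCone τ σ ∧
    Submodule.span ℤ {v} ⊔ latticeOf Λ τ = latticeOf Λ σ

/-- A choice `v_{σ/τ}` of a primitive vector of `σ` modulo `τ`; it is unique up to `Λ_τ`. -/
def primVec {V : Type*} [AddCommGroup V] [Module ℝ V] (Λ : Submodule ℤ V) (τ σ : Set V) : V :=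
  Classical.epsilon (IsPrimitive Λ τ σ)

/-- The data of a weighted complex: its polyhedra, and its weights (only the weights of
facets matter; in a cycle all other sets have weight `0` by convention, so that equality of
weighted complexes means equal polyhedra and equal weights on the facets). -/
@[ext]
structure WeightedComplex (V : Type*) [AddCommGroup V] [Module ℝ V] where
  cells : Set (Set V)
  weight : Set V → ℝ

namespace WeightedComplex

/-- The dimension of a complex: the largest dimension of its polyhedra. -/
def dim {V : Type*} [AddCommGroup V] [Module ℝ V] (X : WeightedComplex V) : ℕ :=
  sSup (polyDim '' X.cells)

/-- The top-dimensional polyhedra. -/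
def facets {V : Type*} [AddCommGroup V] [Module ℝ V] (X : WeightedComplex V) : Set (Set V) :=
  {σ | σ ∈ X.cells ∧ polyDim σ = X.dim}

/-- The polyhedra of codimension one. -/
def ridges {V : Type*} [AddCommGroup V] [Module ℝ V] (X : WeightedComplex V) : Set (Set V) :=
  {τ | τ ∈ X.cells ∧ polyDim τ + 1 = X.dim}

/-- The facets of `X` that have `τ` as a face. -/
def facetsAround {V : Type*} [AddCommGroup V] [Module ℝ V] (X : WeightedComplex V) (τ : Set V) :
    Set (Set V) :=
  {σ | σ ∈ X.facets ∧ IsFace τ σ}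

/-- The weighted sum of the primitive vectors of the facets around `τ`. -/
def primSum {V : Type*} [AddCommGroup V] [Module ℝ V] (Λ : Submodule ℤ V)
    (X : WeightedComplex V) (τ : Set V) : V :=
  ∑ᶠ σ ∈ X.facetsAround τ, X.weight σ • primVec Λ τ σ

/-- Transport of a weighted complex along a linear isomorphism. -/
def map {V W : Type*} [AddCommGroup V] [Module ℝ V] [AddCommGroup W] [Module ℝ W]
    (e : V ≃ₗ[ℝ] W) (X : WeightedComplex V) : WeightedComplex W where
  cells := (fun σ => e '' σ) '' X.cells
  weight c := X.weight (e ⁻¹' c)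

/-- All polyhedra of the complex are cones. -/
def IsFan {V : Type*} [AddCommGroup V] [Module ℝ V] (X : WeightedComplex V) : Prop :=
  ∀ c ∈ X.cells, (0 : V) ∈ c ∧ ∀ t : ℝ, 0 ≤ t → ∀ p ∈ c, t • p ∈ c

/-- A cycle: a finite, pure-dimensional, rational polyhedral complex with integer weights on its
facets that satisfies the balancing condition at each ridge. -/
structure IsCycle {V : Type*} [AddCommGroup V] [Module ℝ V] (Λ : Submodule ℤ V)
    (X : WeightedComplex V) : Prop where
  finite : X.cells.Finite
  nonempty : ∀ σ ∈ X.cells, σ.Nonempty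
  rational : ∀ σ ∈ X.cells, IsRationalPolyhedron Λ σ
  face_mem : ∀ σ ∈ X.cells, ∀ τ, IsFace τ σ → τ ∈ X.cells
  inter_face : ∀ σ ∈ X.cells, ∀ ρ ∈ X.cells, (σ ∩ ρ).Nonempty →
    IsFace (σ ∩ ρ) σ ∧ IsFace (σ ∩ ρ) ρ
  pure : ∀ τ ∈ X.cells, ∃ σ ∈ X.facets, IsFace τ σ
  integral : ∀ σ, ∃ n : ℤ, X.weight σ = n
  weight_eq_zero : ∀ σ, σ ∉ X.facets → X.weight σ = 0
  balanced : ∀ τ ∈ X.ridges, X.primSum Λ τ ∈ vectorSpan ℝ τ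

/-- `φ` is a rational function on `X`: on each polyhedron `σ` of `X` it is integer affine, i.e.
the sum of a linear function with integer values on `Λ_σ` and a real constant. Only the values of
`φ` on the polyhedra of `X` matter. -/
def IsRational {V : Type*} [AddCommGroup V] [Module ℝ V] (Λ : Submodule ℤ V)
    (X : WeightedComplex V) (φ : V → ℝ) : Prop :=
  ∀ σ ∈ X.cells, ∃ (m : V →ₗ[ℝ] ℝ) (c : ℝ),
    (∀ v ∈ latticeOf Λ σ, ∃ n : ℤ, m v = n) ∧ ∀ x ∈ σ, φ x = m x + c

end WeightedComplex

open Classical in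
/-- The linear part `φ_σ` of a function `φ` that is affine on `σ`, as a linear form on `V`; its
restriction to `V_σ` (the only place where it is used) does not depend on the choice. -/
def linPart {V : Type*} [AddCommGroup V] [Module ℝ V] (φ : V → ℝ) (σ : Set V) : V →ₗ[ℝ] ℝ :=
  if h : ∃ m : V →ₗ[ℝ] ℝ, ∃ c : ℝ, ∀ x ∈ σ, φ x = m x + c then h.choose else 0

open Classical in
/-- The divisor `φ · X`: the codimension one skeleton of `X`, where a ridge `τ` has the weight
`∑ ω(σ) φ_σ(v_{σ/τ}) - φ_τ(∑ ω(σ) v_{σ/τ})`, the sums running over the facets `σ` around `τ`. -/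
def divisor {V : Type*} [AddCommGroup V] [Module ℝ V] (Λ : Submodule ℤ V) (φ : V → ℝ)
    (X : WeightedComplex V) : WeightedComplex V where
  cells := X.cells \ X.facets
  weight τ :=
    if τ ∈ X.ridges then
      (∑ᶠ σ ∈ X.facetsAround τ, X.weight σ * linPart φ σ (primVec Λ τ σ))
        - linPart φ τ (X.primSum Λ τ)
    else 0

/-- The multiple intersection product `φ₁ · (φ₂ · ( ⋯ (φ_l · X)))`. -/
def product {V : Type*} [AddCommGroup V] [Module ℝ V] (Λ : Submodule ℤ V) {l : ℕ}
    (φ : Fin l → V → ℝ) (X : WeightedComplex V) : WeightedComplex V :=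
  (List.ofFn φ).foldr (divisor Λ) X

/-- The star of `X` at `τ`: the fan of all `σ̄` with `τ ≤ σ ∈ X` in `V / V_τ`, where `σ̄` has the
weight of `σ` for each facet `σ` around `τ`. (As `σ` is determined by `σ̄`, the sum has at most one
term.) -/
def star {V : Type*} [AddCommGroup V] [Module ℝ V] (X : WeightedComplex V) (τ : Set V) :
    WeightedComplex (V ⧸ vectorSpan ℝ τ) where
  cells := {c | ∃ σ ∈ X.cells, IsFace τ σ ∧ c = starCone τ σ}
  weight c := ∑ᶠ σ ∈ {σ | σ ∈ X.facetsAround τ ∧ starCone τ σ = c}, X.weight σ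

/-- `g` is a germ `φ^τ` of `φ` at `τ`: for some affine function `ψ` that agrees with `φ` on `τ`,
it is the function on the star induced by `φ - ψ`, i.e. on each cone `σ̄` it maps
`t • [x - y]` to `t * (φ - ψ)(x)`, for `x ∈ σ`, `y ∈ τ`, `t ≥ 0`. Only the values of `g` on the
cones of the star matter. -/
def IsGerm {V : Type*} [AddCommGroup V] [Module ℝ V] (X : WeightedComplex V) (φ : V → ℝ)
    (τ : Set V) (g : V ⧸ vectorSpan ℝ τ → ℝ) : Prop :=
  ∃ ψ : V →ᵃ[ℝ] ℝ, (∀ y ∈ τ, φ y = ψ y) ∧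
    ∀ σ ∈ X.cells, IsFace τ σ → ∀ x ∈ σ, ∀ y ∈ τ, ∀ t : ℝ, 0 ≤ t →
      g (t • (vectorSpan ℝ τ).mkQ (x - y)) = t * (φ x - ψ x)

end

end TropicalCycle

namespace TropicalCycle

open WeightedComplex

variable {V : Type*} [AddCommGroup V] [Module ℝ V]

/-! Everything is local at `τ`. If `y₀` is a relatively interior point of `τ`, then `σ̄` consists of
the classes of those `w` for which `y₀ + δ w` stays in `σ` for small `δ ≥ 0`
(`mkQ_mem_starCone_iff`). Hence passing to cones commutes with intersections. Since faces are the
same as non-empty convex extreme subsets (`isFace_iff`), every face of `σ̄` is the cone of a face of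
`σ` containing `τ`. So `σ ↦ σ̄` is injective, preserves and reflects faces, and lowers dimensions by
`dim τ`; it matches facets with facets and ridges with ridges.

The lattice data of a ridge `ρ` of a facet `σ` are stored in a primitive integral normal form `N`
(`IsNormal`): the primitive vectors are exactly the `v ∈ Λ_σ` with `N v = 1`. As `N` kills `V_τ`, it
descends to the quotient, so primitive vectors map to primitive vectors and balancing passes to the
star. By balancing, the weight of `ρ` in `φ · X` is `∑ ω(σ) (φ_σ - φ_ρ)(v_{σ/ρ})`, with `φ_ρ`
extended to a linear form on `V` (`divisor_weight`). Subtracting one affine function from `φ`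
changes no summand, which gives (c). Induction gives (d), and (e) is (d) read off at the cone `{0}`
of `τ`. For (a), both cones are generated by the differences of points of `ρ` and `σ`; for (b), the
affine corrections used by the three germs differ by a function vanishing on `σ`.

The induction needs `φ · X` to be balanced at a face `τ` of codimension two in `X`. A facet `σ`
around `τ` has exactly two ridges containing `τ` (`exists_two_ridges`). The two lattice bases `(u,
v)` of `Λ_σ / Λ_τ` that they define have opposite orientation, so the contractions `m(v) u - m(u) v`
of `u ∧ v` with a form `m` cancel (`wedge_add_wedge_mem`). Summing these contractions over all pairs
of a ridge and a facet, once by facets and once by ridges, proves the balancing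
(`divisor_balanced`). -/

/-! ### Polyhedra, faces and extreme subsets -/

/-- The polyhedron cut out by finitely many inequalities `p.2 ≤ p.1 x`. -/
def halfSpaces (s : Finset ((V →ₗ[ℝ] ℝ) × ℝ)) : Set V := {x | ∀ p ∈ s, p.2 ≤ p.1 x}

theorem convex_halfSpaces (s : Finset ((V →ₗ[ℝ] ℝ) × ℝ)) : Convex ℝ (halfSpaces s) := by
  intro x hx y hy a b ha hb hab p hp
  have h1 := mul_le_mul_of_nonneg_left (hx p hp) ha
  have h2 := mul_le_mul_of_nonneg_left (hy p hp) hb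
  simp only [map_add, map_smul, smul_eq_mul]
  have : p.2 = a * p.2 + b * p.2 := by rw [← add_mul, hab, one_mul]
  linarith

theorem IsRationalPolyhedron.convex {Λ : Submodule ℤ V} {σ : Set V}
    (h : IsRationalPolyhedron Λ σ) : Convex ℝ σ := by
  obtain ⟨s, -, rfl⟩ := h
  exact convex_halfSpaces s

theorem IsFace.subset {τ σ : Set V} (h : IsFace τ σ) : τ ⊆ σ := by
  obtain ⟨-, f, rfl⟩ := h
  exact fun x hx => hx.1

theorem isFace_refl {σ : Set V} (h : σ.Nonempty) : IsFace σ σ :=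
  ⟨h, 0, by ext; simp⟩

theorem IsFace.of_subset {τ ρ σ : Set V} (h : IsFace τ σ) (h1 : τ ⊆ ρ) (h2 : ρ ⊆ σ) :
    IsFace τ ρ := by
  obtain ⟨⟨y, hy⟩, f, rfl⟩ := h
  refine ⟨⟨y, hy⟩, f, ?_⟩
  ext x
  constructor
  · exact fun hx => ⟨h1 hx, fun z hz => hx.2 z (h2 hz)⟩
  · exact fun hx => ⟨h2 hx.1, fun z hz => (hx.2 y (h1 hy)).trans (hy.2 z hz)⟩

theorem IsFace.isExtreme {τ σ : Set V} (h : IsFace τ σ) : IsExtreme ℝ σ τ := by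
  refine ⟨h.subset, ?_⟩
  obtain ⟨-, f, rfl⟩ := h
  rintro x hx y hy z hz ⟨a, b, ha, hb, hab, rfl⟩
  refine ⟨hx, fun w hw => ?_⟩
  have h1 := hz.2 w hw
  have h2 := hz.2 y hy
  simp only [map_add, map_smul, smul_eq_mul] at h1 h2
  have hb' : b = 1 - a := by linarith
  subst hb'
  have h3 : f x ≤ f y := by
    have : a * (f x - f y) ≤ 0 := by linarith
    nlinarith
  have : a * f x + (1 - a) * f y ≥ a * f x + (1 - a) * f x := by nlinarith
  linarith

theorem IsFace.convex {τ σ : Set V} (h : IsFace τ σ) (hσ : Convex ℝ σ) : Convex ℝ τ := by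
  obtain ⟨-, f, rfl⟩ := h
  intro x hx y hy a b ha hb hab
  refine ⟨hσ hx.1 hy.1 ha hb hab, fun z hz => ?_⟩
  have h1 := mul_le_mul_of_nonneg_left (hx.2 z hz) ha
  have h2 := mul_le_mul_of_nonneg_left (hy.2 z hz) hb
  simp only [map_add, map_smul, smul_eq_mul]
  have : f z = a * f z + b * f z := by rw [← add_mul, hab, one_mul]
  linarith

theorem map_eq_zero_of_mem_vectorSpan {τ : Set V} {f : V →ₗ[ℝ] ℝ}
    (h : ∀ x ∈ τ, ∀ y ∈ τ, f x = f y) {v : V} (hv : v ∈ vectorSpan ℝ τ) : f v = 0 := by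
  have : vectorSpan ℝ τ ≤ LinearMap.ker f := by
    rw [vectorSpan_def, Submodule.span_le]
    rintro _ ⟨x, hx, y, hy, rfl⟩
    simp [h x hx y hy]
  exact this hv

theorem sub_mem_vectorSpan {τ : Set V} {x y : V} (hx : x ∈ τ) (hy : y ∈ τ) :
    x - y ∈ vectorSpan ℝ τ := vsub_mem_vectorSpan ℝ hx hy

/-- In a convex set satisfying finitely many inequalities there is a point at which only those
inequalities are sharp that are sharp on the whole set. -/
theorem exists_core_point (s : Finset ((V →ₗ[ℝ] ℝ) × ℝ)) {F : Set V} (hF : Convex ℝ F)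
    (hne : F.Nonempty) (hs : F ⊆ halfSpaces s) :
    ∃ y ∈ F, ∀ p ∈ s, p.1 y = p.2 → ∀ x ∈ F, p.1 x = p.2 := by
  classical
  induction s using Finset.induction_on with
  | empty => obtain ⟨y, hy⟩ := hne; exact ⟨y, hy, by simp⟩
  | insert p s hp ih =>
    obtain ⟨y, hy, h⟩ := ih fun x hx q hq => hs hx q (Finset.mem_insert_of_mem hq)
    by_cases hpF : ∀ x ∈ F, p.1 x = p.2
    · refine ⟨y, hy, fun q hq => ?_⟩
      obtain rfl | hq := Finset.mem_insert.1 hq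
      · exact fun _ => hpF
      · exact h q hq
    · push Not at hpF
      obtain ⟨z, hz, hpz⟩ := hpF
      -- An inequality sharp at the midpoint is sharp at both ends, so the new point loses no
      -- strictness and gains that of `p` at `z`.
      refine ⟨(1 / 2 : ℝ) • y + (1 / 2 : ℝ) • z,
        hF hy hz (by norm_num) (by norm_num) (by norm_num), fun q hq hqe => ?_⟩
      have h1 := hs hy q hq
      have h2 := hs hz q hq
      simp only [map_add, map_smul, smul_eq_mul] at hqe
      obtain rfl | hq := Finset.mem_insert.1 hq
      · exact absurd (by linarith) hpz
      · exact h q hq (by linarith)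

/-- Inequalities strict at `y` survive a short step, and those sharp at `y` are not decreased by
`w`; finitely many bounds have a positive minimum. -/
theorem exists_step (s : Finset ((V →ₗ[ℝ] ℝ) × ℝ)) {y : V} (hy : y ∈ halfSpaces s) {w : V}
    (hw : ∀ p ∈ s, p.1 y = p.2 → 0 ≤ p.1 w) :
    ∃ ε : ℝ, 0 < ε ∧ ∀ δ : ℝ, 0 ≤ δ → δ ≤ ε → y + δ • w ∈ halfSpaces s := by
  classical
  induction s using Finset.induction_on with
  | empty => exact ⟨1, one_pos, fun _ _ _ => by simp [halfSpaces]⟩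
  | insert p s hp ih =>
    obtain ⟨ε, hε, h⟩ := ih (fun q hq => hy q (Finset.mem_insert_of_mem hq))
      (fun q hq => hw q (Finset.mem_insert_of_mem hq))
    have hpy := hy p (Finset.mem_insert_self _ _)
    obtain ⟨η, hη, hη'⟩ : ∃ η : ℝ, 0 < η ∧ ∀ δ : ℝ, 0 ≤ δ → δ ≤ η → p.2 ≤ p.1 (y + δ • w) := by
      by_cases h0 : 0 ≤ p.1 w
      · refine ⟨1, one_pos, fun δ hδ _ => ?_⟩
        have := mul_nonneg hδ h0
        simp only [map_add, map_smul, smul_eq_mul]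
        linarith
      · have h1 : p.2 < p.1 y := lt_of_le_of_ne hpy fun he =>
          h0 (hw p (Finset.mem_insert_self _ _) he.symm)
        push Not at h0
        refine ⟨(p.1 y - p.2) / (-p.1 w), div_pos (by linarith) (by linarith), fun δ hδ hδ' => ?_⟩
        rw [le_div_iff₀ (by linarith)] at hδ'
        simp only [map_add, map_smul, smul_eq_mul]
        linarith
    refine ⟨min ε η, lt_min hε hη, fun δ h0 hδ q hq => ?_⟩
    obtain rfl | hq := Finset.mem_insert.1 hq
    · exact hη' δ h0 (hδ.trans (min_le_right _ _))
    · exact h δ h0 (hδ.trans (min_le_left _ _)) q hq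

/-- A non-empty convex extreme subset of a polyhedron is cut out by sharp inequalities. -/
theorem mem_of_isExtreme {s : Finset ((V →ₗ[ℝ] ℝ) × ℝ)} {τ : Set V} (hne : τ.Nonempty)
    (hc : Convex ℝ τ) (he : IsExtreme ℝ (halfSpaces s) τ) {x : V} (hx : x ∈ halfSpaces s)
    (h : ∀ p ∈ s, (∀ y ∈ τ, p.1 y = p.2) → p.1 x = p.2) : x ∈ τ := by
  obtain ⟨y, hy, hcore⟩ := exists_core_point s hc hne he.subset
  -- From a core point `y` one can move a little away from `x` inside the polyhedron. Then `y` lies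
  -- strictly between `x` and the new point, and extremality puts `x` into `τ`.
  obtain ⟨ε, hε, hstep⟩ := exists_step s (he.subset hy) (w := y - x) (by
    intro p hp hpy
    rw [map_sub, hpy, h p hp (hcore p hp hpy), sub_self])
  refine he.left_mem_of_mem_openSegment hx (hstep ε hε.le le_rfl) hy
    ⟨ε / (1 + ε), 1 / (1 + ε), by positivity, by positivity, by field_simp; ring, ?_⟩
  have h1 : (1 + ε) ≠ 0 := by positivity
  have : (1 / (1 + ε)) * (1 + ε) = 1 := by field_simp
  calc (ε / (1 + ε)) • x + (1 / (1 + ε)) • (y + ε • (y - x))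
      = ((1 / (1 + ε)) * (1 + ε)) • y := by module
    _ = y := by rw [this, one_smul]

/-- The exposing form is the sum of all defining forms that are sharp on `τ`: it is minimal only
where every summand is sharp. -/
theorem isFace_of_isExtreme {s : Finset ((V →ₗ[ℝ] ℝ) × ℝ)} {τ : Set V} (hne : τ.Nonempty)
    (hc : Convex ℝ τ) (he : IsExtreme ℝ (halfSpaces s) τ) : IsFace τ (halfSpaces s) := by
  classical
  set A := s.filter fun p => ∀ y ∈ τ, p.1 y = p.2 with hA
  have hval : ∀ y ∈ τ, (∑ p ∈ A, p.1) y = ∑ p ∈ A, p.2 := fun y hy => by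
    rw [LinearMap.sum_apply]
    exact Finset.sum_congr rfl fun p hp => (Finset.mem_filter.1 hp).2 y hy
  have hle : ∀ x ∈ halfSpaces s, ∑ p ∈ A, p.2 ≤ (∑ p ∈ A, p.1) x := fun x hx => by
    rw [LinearMap.sum_apply]
    exact Finset.sum_le_sum fun p hp => hx p (Finset.mem_filter.1 hp).1
  refine ⟨hne, ∑ p ∈ A, p.1, Set.Subset.antisymm (fun y hy => ⟨he.subset hy, fun x hx => ?_⟩) ?_⟩
  · rw [hval y hy]; exact hle x hx
  · rintro x ⟨hx, hmin⟩
    obtain ⟨y, hy⟩ := hne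
    have h1 := hmin y (he.subset hy)
    rw [hval y hy] at h1
    have h2 := le_antisymm h1 (hle x hx)
    rw [LinearMap.sum_apply] at h2
    have h3 := (Finset.sum_eq_sum_iff_of_le fun p hp => hx p (Finset.mem_filter.1 hp).1).1 h2.symm
    exact mem_of_isExtreme ⟨y, hy⟩ hc he hx fun p hp hpa =>
      (h3 p (Finset.mem_filter.2 ⟨hp, hpa⟩)).symm

/-- Convexity and extremality compose and pull back along affine maps, which is not evident for
minimal loci of linear forms. Transitivity of faces and the faces of `σ̄` rest on this. -/
theorem isFace_iff {Λ : Submodule ℤ V} {τ σ : Set V} (hσ : IsRationalPolyhedron Λ σ) :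
    IsFace τ σ ↔ τ.Nonempty ∧ Convex ℝ τ ∧ IsExtreme ℝ σ τ := by
  refine ⟨fun h => ⟨h.1, h.convex hσ.convex, h.isExtreme⟩, ?_⟩
  obtain ⟨s, -, rfl⟩ := hσ
  exact fun h => isFace_of_isExtreme h.1 h.2.1 h.2.2

theorem IsFace.trans {Λ : Submodule ℤ V} {τ ρ σ : Set V} (hσ : IsRationalPolyhedron Λ σ)
    (h1 : IsFace τ ρ) (h2 : IsFace ρ σ) : IsFace τ σ :=
  (isFace_iff hσ).2 ⟨h1.1, h1.convex (h2.convex hσ.convex), h2.isExtreme.trans h1.isExtreme⟩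

/-- The locus where one of the inequalities is sharp is a face. -/
theorem isFace_of_sharp {s : Finset ((V →ₗ[ℝ] ℝ) × ℝ)} {p : (V →ₗ[ℝ] ℝ) × ℝ} (hp : p ∈ s) {y : V}
    (hy : y ∈ halfSpaces s) (hpy : p.1 y = p.2) :
    IsFace {x | x ∈ halfSpaces s ∧ p.1 x = p.2} (halfSpaces s) := by
  refine ⟨⟨y, hy, hpy⟩, p.1, ?_⟩
  ext x
  constructor
  · rintro ⟨hx, hpx⟩
    exact ⟨hx, fun z hz => hpx ▸ hz p hp⟩
  · rintro ⟨hx, hmin⟩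
    exact ⟨hx, le_antisymm (hpy ▸ hmin y hy) (hx p hp)⟩

/-! ### Relative interior and linear spaces of polyhedra -/

/-- `y` is a relatively interior point of `τ`. -/
def IsRelInt (τ : Set V) (y : V) : Prop :=
  y ∈ τ ∧ ∀ v ∈ vectorSpan ℝ τ, ∃ ε : ℝ, 0 < ε ∧ ∀ δ : ℝ, 0 ≤ δ → δ ≤ ε → y + δ • v ∈ τ

theorem isRelInt_of_core {s : Finset ((V →ₗ[ℝ] ℝ) × ℝ)} {y : V}
    (hy : y ∈ halfSpaces s) (hcore : ∀ p ∈ s, p.1 y = p.2 → ∀ x ∈ halfSpaces s, p.1 x = p.2) :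
    IsRelInt (halfSpaces s) y := by
  refine ⟨hy, fun v hv => exists_step s hy fun p hp hpy => ?_⟩
  rw [map_eq_zero_of_mem_vectorSpan
    (fun x hx z hz => (hcore p hp hpy x hx).trans (hcore p hp hpy z hz).symm) hv]

/-- A direction killed by all forms that are sharp on the whole polyhedron can be followed for a
short time from a core point, so it is a multiple of a difference of two points. -/
theorem mem_vectorSpan_iff {s : Finset ((V →ₗ[ℝ] ℝ) × ℝ)} (hne : (halfSpaces s).Nonempty) {v : V} :
    v ∈ vectorSpan ℝ (halfSpaces s) ↔
      ∀ p ∈ s, (∀ x ∈ halfSpaces s, p.1 x = p.2) → p.1 v = 0 := by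
  constructor
  · exact fun hv p _ h => map_eq_zero_of_mem_vectorSpan
      (fun x hx z hz => (h x hx).trans (h z hz).symm) hv
  · intro h
    obtain ⟨y, hy, hcore⟩ := exists_core_point s (convex_halfSpaces s) hne subset_rfl
    obtain ⟨ε, hε, hstep⟩ := exists_step s hy (w := v) fun p hp hpy =>
      (h p hp (hcore p hp hpy)).ge
    have := sub_mem_vectorSpan (hstep ε hε.le le_rfl) hy
    rw [add_sub_cancel_left] at this
    exact (Submodule.smul_mem_iff _ hε.ne').1 this

theorem IsRationalPolyhedron.exists_isRelInt {Λ : Submodule ℤ V} {σ : Set V}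
    (h : IsRationalPolyhedron Λ σ) (hne : σ.Nonempty) : ∃ y, IsRelInt σ y := by
  obtain ⟨s, -, rfl⟩ := h
  obtain ⟨y, hy, hcore⟩ := exists_core_point s (convex_halfSpaces s) hne subset_rfl
  exact ⟨y, isRelInt_of_core hy hcore⟩

/-- A form that is sharp at a relatively interior point is sharp everywhere. -/
theorem IsRelInt.eq_of_le {τ : Set V} {y : V} (h : IsRelInt τ y) {f : V →ₗ[ℝ] ℝ} {c : ℝ}
    (hf : ∀ x ∈ τ, c ≤ f x) (hy : f y = c) : ∀ x ∈ τ, f x = c := by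
  intro x hx
  obtain ⟨ε, hε, hstep⟩ := h.2 _ (sub_mem_vectorSpan h.1 hx)
  have h1 := hf _ (hstep ε hε.le le_rfl)
  simp only [map_add, map_smul, map_sub, smul_eq_mul, hy] at h1
  have h2 := hf x hx
  nlinarith

theorem IsFace.vectorSpan_le {τ σ : Set V} (h : IsFace τ σ) :
    vectorSpan ℝ τ ≤ vectorSpan ℝ σ := vectorSpan_mono ℝ h.subset

/-- A face with the linear space of the whole polyhedron is the polyhedron. -/
theorem IsFace.eq_of_vectorSpan_le {τ σ : Set V} (h : IsFace τ σ)
    (hle : vectorSpan ℝ σ ≤ vectorSpan ℝ τ) : τ = σ := by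
  refine h.subset.antisymm fun x hx => ?_
  obtain ⟨⟨y, hy⟩, f, hf⟩ := h
  have hmem : ∀ z, z ∈ τ ↔ z ∈ σ ∧ ∀ y ∈ σ, f z ≤ f y := fun z => by rw [hf]; rfl
  have hyσ := (hmem y).1 hy
  have : f (x - y) = 0 := map_eq_zero_of_mem_vectorSpan
    (fun a ha b hb => le_antisymm (((hmem a).1 ha).2 b ((hmem b).1 hb).1)
      (((hmem b).1 hb).2 a ((hmem a).1 ha).1)) (hle (sub_mem_vectorSpan hx hyσ.1))
  rw [map_sub, sub_eq_zero] at this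
  exact (hmem x).2 ⟨hx, fun z hz => this ▸ hyσ.2 z hz⟩

theorem IsFace.polyDim_lt [FiniteDimensional ℝ V] {τ σ : Set V} (h : IsFace τ σ) (hne : τ ≠ σ) :
    polyDim τ < polyDim σ := by
  refine Submodule.finrank_lt_finrank_of_lt (lt_of_le_not_ge h.vectorSpan_le fun hle => ?_)
  exact hne (h.eq_of_vectorSpan_le hle)

theorem IsFace.polyDim_le [FiniteDimensional ℝ V] {τ σ : Set V} (h : IsFace τ σ) :
    polyDim τ ≤ polyDim σ := Submodule.finrank_mono h.vectorSpan_le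

theorem IsFace.eq_of_polyDim_le [FiniteDimensional ℝ V] {τ σ : Set V} (h : IsFace τ σ)
    (hd : polyDim σ ≤ polyDim τ) : τ = σ := by
  by_contra hne
  exact absurd (h.polyDim_lt hne) (not_lt.2 hd)

/-! ### The cones of the star and their faces -/

theorem mkQ_sub_mem_starCone {τ σ : Set V} {x y : V} (hx : x ∈ σ) (hy : y ∈ τ) :
    (vectorSpan ℝ τ).mkQ (x - y) ∈ starCone τ σ :=
  ⟨1, zero_le_one, x, hx, y, hy, (one_smul _ _).symm⟩

theorem smul_mem_starCone {τ σ : Set V} {t : ℝ} (ht : 0 ≤ t) {p : V ⧸ vectorSpan ℝ τ}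
    (hp : p ∈ starCone τ σ) : t • p ∈ starCone τ σ := by
  obtain ⟨s, hs, x, hx, y, hy, rfl⟩ := hp
  exact ⟨t * s, mul_nonneg ht hs, x, hx, y, hy, by rw [mul_smul]⟩

theorem zero_mem_starCone {τ σ : Set V} (h : IsFace τ σ) : 0 ∈ starCone τ σ := by
  obtain ⟨y, hy⟩ := h.1
  simpa using mkQ_sub_mem_starCone (h.subset hy) hy

theorem starCone_mono {τ ρ σ : Set V} (h : ρ ⊆ σ) : starCone τ ρ ⊆ starCone τ σ := by
  rintro _ ⟨t, ht, x, hx, y, hy, rfl⟩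
  exact ⟨t, ht, x, h hx, y, hy, rfl⟩

theorem starCone_self {τ : Set V} (h : τ.Nonempty) : starCone τ τ = {0} := by
  refine Set.Subset.antisymm ?_ (Set.singleton_subset_iff.2 (zero_mem_starCone (isFace_refl h)))
  rintro _ ⟨t, ht, x, hx, y, hy, rfl⟩
  rw [Submodule.mkQ_apply, (Submodule.Quotient.mk_eq_zero _).2 (sub_mem_vectorSpan hx hy),
    smul_zero]
  rfl

/-- The cone of `σ` consists of the directions that stay in `σ` for a short time, starting from a
relatively interior point of `τ`. -/
theorem mkQ_mem_starCone_iff {τ σ : Set V} (hτσ : τ ⊆ σ) (hσ : Convex ℝ σ) {y₀ : V}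
    (hy₀ : IsRelInt τ y₀) {w : V} :
    (vectorSpan ℝ τ).mkQ w ∈ starCone τ σ ↔
      ∃ ε : ℝ, 0 < ε ∧ ∀ δ : ℝ, 0 ≤ δ → δ ≤ ε → y₀ + δ • w ∈ σ := by
  constructor
  · rintro ⟨t, ht, x, hx, y, hy, hw⟩
    have hv : w - t • (x - y) ∈ vectorSpan ℝ τ := by
      rw [← map_smul] at hw
      exact (Submodule.Quotient.eq _).1 hw
    -- With `u` this vector, `y₀ + δ w = (1 - δ t) (y₀ + δ / (1 - δ t) u) + δ t x`, a convex
    -- combination of a point of `τ` and a point of `σ`. The bounds below give `δ t ≤ 1 / 2` and `δ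
    -- / (1 - δ t) ≤ ε`.
    have hu : (w - t • (x - y)) + t • (y₀ - y) ∈ vectorSpan ℝ τ :=
      Submodule.add_mem _ hv (Submodule.smul_mem _ _ (sub_mem_vectorSpan hy₀.1 hy))
    obtain ⟨ε, hε, hstep⟩ := hy₀.2 _ hu
    refine ⟨min (ε / 2) (1 / (2 * (t + 1))), lt_min (by positivity) (by positivity),
      fun δ h0 hδ => ?_⟩
    have h1 : δ ≤ ε / 2 := hδ.trans (min_le_left _ _)
    have h2 : δ * (2 * (t + 1)) ≤ 1 := by
      rw [← le_div_iff₀ (by positivity)]; exact hδ.trans (min_le_right _ _)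
    have h3 : (1 / 2 : ℝ) ≤ 1 - δ * t := by nlinarith
    have h4 : (0 : ℝ) < 1 - δ * t := by linarith
    have h5 := hτσ (hstep (δ / (1 - δ * t)) (by positivity) (by
      rw [div_le_iff₀ h4]; nlinarith))
    have h6 := hσ h5 hx h4.le (mul_nonneg h0 ht) (by ring)
    convert h6 using 1
    have h7 : (1 - δ * t) * (δ / (1 - δ * t)) = δ := by field_simp
    rw [smul_add, smul_smul, h7]
    module
  · rintro ⟨ε, hε, hstep⟩
    refine ⟨1 / ε, by positivity, _, hstep ε hε.le le_rfl, y₀, hy₀.1, ?_⟩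
    rw [add_sub_cancel_left, ← map_smul, smul_smul, one_div_mul_cancel hε.ne', one_smul]

/-- In the local description both cones are tested at the same point `y₀`, so the shorter of the two
times serves for the intersection. -/
theorem starCone_inter {τ σ ρ : Set V} (hτσ : τ ⊆ σ) (hτρ : τ ⊆ ρ) (hσ : Convex ℝ σ)
    (hρ : Convex ℝ ρ) {y₀ : V} (hy₀ : IsRelInt τ y₀) :
    starCone τ (σ ∩ ρ) = starCone τ σ ∩ starCone τ ρ := by
  ext p
  obtain ⟨w, rfl⟩ := Submodule.mkQ_surjective _ p
  rw [Set.mem_inter_iff, mkQ_mem_starCone_iff (Set.subset_inter hτσ hτρ) (hσ.inter hρ) hy₀,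
    mkQ_mem_starCone_iff hτσ hσ hy₀, mkQ_mem_starCone_iff hτρ hρ hy₀]
  constructor
  · rintro ⟨ε, hε, h⟩
    exact ⟨⟨ε, hε, fun δ h0 h1 => (h δ h0 h1).1⟩, ⟨ε, hε, fun δ h0 h1 => (h δ h0 h1).2⟩⟩
  · rintro ⟨⟨ε, hε, h⟩, ⟨η, hη, h'⟩⟩
    exact ⟨min ε η, lt_min hε hη, fun δ h0 h1 => ⟨h δ h0 (h1.trans (min_le_left _ _)),
      h' δ h0 (h1.trans (min_le_right _ _))⟩⟩

/-- The linear form on the quotient by `V_τ` induced by a form that is constant on `τ`. -/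
theorem exists_quotient_form {τ : Set V} {f : V →ₗ[ℝ] ℝ} (h : ∀ v ∈ vectorSpan ℝ τ, f v = 0) :
    ∃ g : V ⧸ vectorSpan ℝ τ →ₗ[ℝ] ℝ, ∀ v, g ((vectorSpan ℝ τ).mkQ v) = f v :=
  ⟨(vectorSpan ℝ τ).liftQ f h, fun _ => rfl⟩

theorem IsFace.exists_form {τ σ : Set V} (h : IsFace τ σ) : ∃ (f : V →ₗ[ℝ] ℝ) (c : ℝ),
    (∀ x ∈ σ, c ≤ f x) ∧ (∀ x ∈ σ, x ∈ τ ↔ f x = c) := by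
  obtain ⟨⟨y, hy⟩, f, rfl⟩ := h
  refine ⟨f, f y, hy.2, fun x hx => ⟨fun h => le_antisymm (h.2 _ hy.1) (hy.2 _ hx), fun h =>
    ⟨hx, h ▸ hy.2⟩⟩⟩

/-- The form that exposes `ρ` in `σ` is constant on `τ`, hence descends to the quotient, where it
vanishes on the cone of `ρ`. -/
theorem mem_of_mkQ_mem_starCone {τ ρ σ : Set V} (hτρ : τ ⊆ ρ) (hρσ : IsFace ρ σ) {x y : V}
    (hx : x ∈ σ) (hy : y ∈ τ) (h : (vectorSpan ℝ τ).mkQ (x - y) ∈ starCone τ ρ) : x ∈ ρ := by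
  obtain ⟨f, c, -, hf⟩ := hρσ.exists_form
  have hc : ∀ z ∈ ρ, f z = c := fun z hz => (hf z (hρσ.subset hz)).1 hz
  obtain ⟨g, hg⟩ := exists_quotient_form (f := f) (τ := τ) fun v hv =>
    map_eq_zero_of_mem_vectorSpan
      (fun a ha b hb => (hc a (hτρ ha)).trans (hc b (hτρ hb)).symm) hv
  obtain ⟨t, -, x', hx', y', hy', h⟩ := h
  have h1 := congrArg g h
  rw [map_smul, hg, hg, map_sub, map_sub, hc _ (hτρ hy), hc _ hx', hc _ (hτρ hy'), sub_self,
    smul_zero, sub_eq_zero] at h1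
  exact (hf x hx).2 h1

theorem eq_of_starCone_subset {τ ρ σ : Set V} (hτρ : IsFace τ ρ) (hρσ : IsFace ρ σ)
    (h : starCone τ σ ⊆ starCone τ ρ) : ρ = σ := by
  obtain ⟨y, hy⟩ := hτρ.1
  exact hρσ.subset.antisymm fun x hx =>
    mem_of_mkQ_mem_starCone hτρ.subset hρσ hx hy (h (mkQ_sub_mem_starCone hx hy))

theorem isFace_starCone {τ ρ σ : Set V} (hτρ : IsFace τ ρ) (hρσ : IsFace ρ σ) :
    IsFace (starCone τ ρ) (starCone τ σ) := by
  obtain ⟨f, c, hle, hf⟩ := hρσ.exists_form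
  have hc : ∀ z ∈ ρ, f z = c := fun z hz => (hf z (hρσ.subset hz)).1 hz
  obtain ⟨g, hg⟩ := exists_quotient_form (f := f) (τ := τ) fun v hv =>
    map_eq_zero_of_mem_vectorSpan
      (fun a ha b hb => (hc a (hτρ.subset ha)).trans (hc b (hτρ.subset hb)).symm) hv
  have hval : ∀ (t : ℝ), ∀ x ∈ σ, ∀ y ∈ τ,
      g (t • (vectorSpan ℝ τ).mkQ (x - y)) = t * (f x - c) := fun t x hx y hy => by
    rw [map_smul, hg, map_sub, hc y (hτρ.subset hy), smul_eq_mul]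
  refine ⟨⟨0, zero_mem_starCone hτρ⟩, g, Set.Subset.antisymm ?_ ?_⟩
  · rintro _ ⟨t, ht, x, hx, y, hy, rfl⟩
    refine ⟨⟨t, ht, x, hρσ.subset hx, y, hy, rfl⟩, ?_⟩
    rintro _ ⟨t', ht', x', hx', y', hy', rfl⟩
    rw [hval _ _ (hρσ.subset hx) _ hy, hval _ _ hx' _ hy', hc x hx, sub_self, mul_zero]
    exact mul_nonneg ht' (sub_nonneg.2 (hle x' hx'))
  · rintro _ ⟨⟨t, ht, x, hx, y, hy, rfl⟩, hmin⟩
    have h1 := hmin 0 (starCone_mono hρσ.subset (zero_mem_starCone hτρ))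
    rw [hval _ _ hx _ hy, map_zero] at h1
    have h2 : t * (f x - c) = 0 :=
      le_antisymm h1 (mul_nonneg ht (sub_nonneg.2 (hle x hx)))
    rcases mul_eq_zero.1 h2 with h | h
    · rw [h, zero_smul]; exact zero_mem_starCone hτρ
    · exact ⟨t, ht, x, (hf x hx).2 (sub_eq_zero.1 h), y, hy, rfl⟩

/-- The face `ρ` is the preimage of `G` under the affine map `x ↦ [x - y₀]` on `σ`; it inherits
convexity and extremality from `G`. -/
theorem exists_eq_starCone_of_isFace {Λ : Submodule ℤ V} {τ σ : Set V}
    (hσ : IsRationalPolyhedron Λ σ) (hτσ : IsFace τ σ) {G : Set (V ⧸ vectorSpan ℝ τ)}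
    (hcone : Convex ℝ (starCone τ σ)) (hG : IsFace G (starCone τ σ)) :
    ∃ ρ, IsFace τ ρ ∧ IsFace ρ σ ∧ G = starCone τ ρ := by
  have hGc := hG.convex hcone
  have hGe := hG.isExtreme
  -- A face of a cone is a cone: `p` is the midpoint of `0` and `2 p`, and `t p / (1 + t)` lies
  -- between `t p` and `0`, so extremality applies to both segments.
  have hseg : ∀ (p : V ⧸ vectorSpan ℝ τ) (t : ℝ), 0 < t → p ∈ G → t • p ∈ G ∧ 0 ∈ G := by
    intro p t ht hp
    have hp' := hGe.subset hp
    have h0 : (0 : V ⧸ vectorSpan ℝ τ) ∈ G := by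
      refine hGe.left_mem_of_mem_openSegment (zero_mem_starCone hτσ)
        (smul_mem_starCone zero_le_two hp') hp ⟨1 / 2, 1 / 2, by norm_num, by norm_num,
          by norm_num, ?_⟩
      module
    refine ⟨?_, h0⟩
    refine hGe.left_mem_of_mem_openSegment (smul_mem_starCone ht.le hp') (zero_mem_starCone hτσ)
      (hGc hp h0 (a := t / (1 + t)) (b := 1 / (1 + t)) (by positivity) (by positivity)
        (by field_simp; ring)) ⟨1 / (1 + t), t / (1 + t), by positivity, by positivity,
          by field_simp, ?_⟩
    module
  have h0 : (0 : V ⧸ vectorSpan ℝ τ) ∈ G := by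
    obtain ⟨p, hp⟩ := hG.1
    exact (hseg p 1 one_pos hp).2
  obtain ⟨y₀, hy₀⟩ := hτσ.1
  set ρ : Set V := {x | x ∈ σ ∧ (vectorSpan ℝ τ).mkQ (x - y₀) ∈ G} with hρ
  have hmk : ∀ y ∈ τ, ∀ x, (vectorSpan ℝ τ).mkQ (x - y) = (vectorSpan ℝ τ).mkQ (x - y₀) := by
    intro y hy x
    refine (Submodule.Quotient.eq _).2 ?_
    rw [sub_sub_sub_cancel_left]
    exact sub_mem_vectorSpan hy₀ hy
  have hτρ : τ ⊆ ρ := fun y hy => ⟨hτσ.subset hy, by rw [← hmk y hy, sub_self, map_zero]; exact h0⟩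
  have haff : ∀ x y : V, ∀ a b : ℝ, a + b = 1 → (vectorSpan ℝ τ).mkQ (a • x + b • y - y₀) =
      a • (vectorSpan ℝ τ).mkQ (x - y₀) + b • (vectorSpan ℝ τ).mkQ (y - y₀) := by
    intro x y a b hab
    rw [← map_smul, ← map_smul, ← map_add]
    congr 1
    have : b = 1 - a := by linarith
    subst this
    module
  have hρσ : IsFace ρ σ := by
    refine (isFace_iff hσ).2 ⟨⟨y₀, hτρ hy₀⟩, ?_, fun x hx => hx.1, ?_⟩
    · intro x hx y hy a b ha hb hab
      refine ⟨hσ.convex hx.1 hy.1 ha hb hab, ?_⟩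
      rw [haff x y a b hab]
      exact hGc hx.2 hy.2 ha hb hab
    · rintro x hx y hy z hz ⟨a, b, ha, hb, hab, rfl⟩
      refine ⟨hx, hGe.left_mem_of_mem_openSegment (mkQ_sub_mem_starCone hx hy₀)
        (mkQ_sub_mem_starCone hy hy₀) hz.2 ⟨a, b, ha, hb, hab, (haff x y a b hab).symm⟩⟩
  refine ⟨ρ, hτσ.of_subset hτρ hρσ.subset, hρσ, Set.Subset.antisymm ?_ ?_⟩
  · intro p hp
    obtain ⟨t, ht, x, hx, y, hy, rfl⟩ := hGe.subset hp
    rcases ht.eq_or_lt with rfl | ht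
    · rw [zero_smul]
      exact zero_mem_starCone (hτσ.of_subset hτρ hρσ.subset)
    · refine ⟨t, ht.le, x, ⟨hx, ?_⟩, y, hy, rfl⟩
      have := (hseg _ t⁻¹ (by positivity) hp).1
      rwa [smul_smul, inv_mul_cancel₀ ht.ne', one_smul, hmk y hy] at this
  · rintro _ ⟨t, ht, x, hx, y, hy, rfl⟩
    rcases ht.eq_or_lt with rfl | ht
    · rw [zero_smul]; exact h0
    · rw [hmk y hy]
      exact (hseg _ t ht hx.2).1

/-- Only the inequalities sharp at `y₀` restrict short steps. Their forms kill `V_τ`, and on the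
quotient they become homogeneous inequalities. -/
theorem isRationalPolyhedron_starCone {Λ : Submodule ℤ V} {τ σ : Set V}
    (hσ : IsRationalPolyhedron Λ σ) (hτσ : IsFace τ σ) {y₀ : V} (hy₀ : IsRelInt τ y₀) :
    IsRationalPolyhedron (quotLattice Λ τ) (starCone τ σ) := by
  classical
  have hconv := hσ.convex
  obtain ⟨s, hs, rfl⟩ := hσ
  set A := s.filter fun p => p.1 y₀ = p.2 with hA
  have hker : ∀ p ∈ A, ∀ v ∈ vectorSpan ℝ τ, p.1 v = 0 := by
    intro p hp v hv
    have hp' := Finset.mem_filter.1 hp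
    have hall := hy₀.eq_of_le (f := p.1) (c := p.2) (fun x hx => hτσ.subset hx p hp'.1) hp'.2
    exact map_eq_zero_of_mem_vectorSpan
      (fun a ha b hb => (hall a ha).trans (hall b hb).symm) hv
  refine ⟨A.attach.image fun p : {p // p ∈ A} =>
    ((vectorSpan ℝ τ).liftQ p.1.1 (hker p.1 p.2), (0 : ℝ)), ?_, ?_⟩
  · intro q hq v hv
    obtain ⟨p, -, rfl⟩ := Finset.mem_image.1 hq
    obtain ⟨w, hw, rfl⟩ := hv
    exact hs _ (Finset.mem_filter.1 p.2).1 w hw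
  · ext q
    obtain ⟨w, rfl⟩ := Submodule.mkQ_surjective _ q
    rw [mkQ_mem_starCone_iff hτσ.subset hconv hy₀]
    simp only [Set.mem_ofPred_eq, Finset.mem_image, Finset.mem_attach, true_and,
      forall_exists_index, forall_apply_eq_imp_iff]
    constructor
    · rintro ⟨ε, hε, h⟩ p
      have hp := Finset.mem_filter.1 p.2
      have h1 := h ε hε.le le_rfl p.1 hp.1
      rw [map_add, map_smul, hp.2, smul_eq_mul] at h1
      change 0 ≤ p.1.1 w
      nlinarith
    · intro h
      exact exists_step s (hτσ.subset hy₀.1) fun p hp hpy => h ⟨p, Finset.mem_filter.2 ⟨hp, hpy⟩⟩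

theorem vectorSpan_starCone {τ σ : Set V} (hτσ : IsFace τ σ) :
    vectorSpan ℝ (starCone τ σ) = (vectorSpan ℝ σ).map (vectorSpan ℝ τ).mkQ := by
  apply le_antisymm
  · rw [vectorSpan_def ℝ (starCone τ σ), Submodule.span_le]
    have key : ∀ p ∈ starCone τ σ, p ∈ (vectorSpan ℝ σ).map (vectorSpan ℝ τ).mkQ := by
      rintro _ ⟨t, ht, x, hx, y, hy, rfl⟩
      exact Submodule.smul_mem _ _ ⟨_, sub_mem_vectorSpan hx (hτσ.subset hy), rfl⟩
    rintro _ ⟨p, hp, q, hq, rfl⟩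
    exact Submodule.sub_mem _ (key p hp) (key q hq)
  · rw [Submodule.map_le_iff_le_comap, vectorSpan_def ℝ σ, Submodule.span_le]
    rintro _ ⟨x, hx, x', hx', rfl⟩
    obtain ⟨y, hy⟩ := hτσ.1
    have := sub_mem_vectorSpan (mkQ_sub_mem_starCone hx hy) (mkQ_sub_mem_starCone hx' hy)
    rwa [← map_sub, sub_sub_sub_cancel_right] at this

theorem mkQ_mem_vectorSpan_starCone {τ σ : Set V} (hτσ : IsFace τ σ) {v : V} :
    (vectorSpan ℝ τ).mkQ v ∈ vectorSpan ℝ (starCone τ σ) ↔ v ∈ vectorSpan ℝ σ := by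
  rw [vectorSpan_starCone hτσ]
  constructor
  · rintro ⟨w, hw, hwv⟩
    have h1 := hτσ.vectorSpan_le ((Submodule.Quotient.eq _).1 hwv)
    have := Submodule.sub_mem _ hw h1
    rwa [sub_sub_cancel] at this
  · exact fun h => ⟨v, h, rfl⟩

theorem polyDim_starCone [FiniteDimensional ℝ V] {τ σ : Set V} (hτσ : IsFace τ σ) :
    polyDim (starCone τ σ) + polyDim τ = polyDim σ := by
  unfold polyDim
  rw [vectorSpan_starCone hτσ]
  have h := LinearMap.finrank_range_add_finrank_ker ((vectorSpan ℝ τ).mkQ.domRestrict (vectorSpan ℝ σ))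
  rw [LinearMap.range_domRestrict, LinearMap.ker_domRestrict, Submodule.ker_mkQ] at h
  rw [← h]
  congr 1
  exact (Submodule.comapSubtypeEquivOfLe hτσ.vectorSpan_le).finrank_eq.symm

/-- The cone of `σ ∩ ρ` is the intersection of two equal cones, so it is all of either; a face of
`σ` or of `ρ` whose cone is everything is the whole polyhedron. -/
theorem starCone_injective {Λ : Submodule ℤ V} {τ σ ρ : Set V} (hτ : ∃ y, IsRelInt τ y)
    (hσ : IsRationalPolyhedron Λ σ) (hρ : IsRationalPolyhedron Λ ρ)
    (hτσ : IsFace τ σ) (hτρ : IsFace τ ρ)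
    (h1 : IsFace (σ ∩ ρ) σ) (h2 : IsFace (σ ∩ ρ) ρ) (h : starCone τ σ = starCone τ ρ) : σ = ρ := by
  obtain ⟨y, hy⟩ := hτ
  have hi := starCone_inter hτσ.subset hτρ.subset hσ.convex hρ.convex hy
  have hτi : IsFace τ (σ ∩ ρ) :=
    hτσ.of_subset (Set.subset_inter hτσ.subset hτρ.subset) Set.inter_subset_left
  rw [← h, Set.inter_self] at hi
  exact (eq_of_starCone_subset hτi h1 hi.ge).symm.trans
    (eq_of_starCone_subset hτi h2 (h ▸ hi.ge))

/-! ### Lattices, normal forms and primitive vectors -/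

theorem latticeOf_mono {Λ : Submodule ℤ V} {τ σ : Set V} (h : IsFace τ σ) :
    latticeOf Λ τ ≤ latticeOf Λ σ := fun _ hv => ⟨hv.1, h.vectorSpan_le hv.2⟩

theorem IsLattice.span_eq_top {Λ : Submodule ℤ V} (h : IsLattice Λ) :
    Submodule.span ℝ (Λ : Set V) = ⊤ := by
  obtain ⟨b, rfl⟩ := h
  rw [eq_top_iff, ← b.span_eq]
  exact Submodule.span_mono Submodule.subset_span

/-- The solution space of finitely many integral homogeneous equations is spanned by lattice
vectors. -/
theorem mem_span_of_integral_forms {Λ : Submodule ℤ V} (hΛ : Submodule.span ℝ (Λ : Set V) = ⊤)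
    (A : Finset ((V →ₗ[ℝ] ℝ) × ℝ)) (hA : ∀ p ∈ A, ∀ v ∈ Λ, ∃ n : ℤ, p.1 v = n) {x : V}
    (hx : ∀ p ∈ A, p.1 x = 0) : x ∈ Submodule.span ℝ {v | v ∈ Λ ∧ ∀ p ∈ A, p.1 v = 0} := by
  classical
  induction A using Finset.induction_on generalizing x with
  | empty =>
    have : x ∈ Submodule.span ℝ (Λ : Set V) := hΛ ▸ Submodule.mem_top
    refine Submodule.span_mono ?_ this
    exact fun v hv => ⟨hv, by simp⟩
  | insert p A _ ih =>
    have ih' := ih (fun q hq => hA q (Finset.mem_insert_of_mem hq))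
      (fun q hq => hx q (Finset.mem_insert_of_mem hq))
    have hpx := hx p (Finset.mem_insert_self _ _)
    have hint := hA p (Finset.mem_insert_self _ _)
    by_cases h0 : ∀ v ∈ Λ, (∀ q ∈ A, q.1 v = 0) → p.1 v = 0
    · refine Submodule.span_mono ?_ ih'
      refine fun v hv => ⟨hv.1, fun q hq => ?_⟩
      obtain rfl | hq := Finset.mem_insert.1 hq
      · exact h0 v hv.1 hv.2
      · exact hv.2 q hq
    · push Not at h0
      obtain ⟨v, hv, hvA, hpv⟩ := h0
      -- Up to the factor `p(v)` this is the projection to `ker p` along `v`. Clearing the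
      -- denominator keeps lattice vectors in `Λ`, because `p` is integral there.
      set T : V →ₗ[ℝ] V := p.1 v • LinearMap.id - p.1.smulRight v with hT
      have hTx : T x = p.1 v • x := by simp [hT, hpx]
      rw [← Submodule.smul_mem_iff _ hpv, ← hTx]
      have h1 := Submodule.mem_map_of_mem (f := T) ih'
      rw [Submodule.map_span] at h1
      refine Submodule.span_mono ?_ h1
      rintro _ ⟨w, ⟨hw, hwA⟩, rfl⟩
      have hTw : T w = p.1 v • w - p.1 w • v := by simp [hT]
      rw [hTw]
      obtain ⟨a, ha⟩ := hint v hv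
      obtain ⟨b, hb⟩ := hint w hw
      refine ⟨?_, fun q hq => ?_⟩
      · rw [ha, hb, Int.cast_smul_eq_zsmul, Int.cast_smul_eq_zsmul]
        exact Λ.sub_mem (Λ.smul_mem a hw) (Λ.smul_mem b hv)
      · rw [map_sub, map_smul, map_smul]
        obtain rfl | hq := Finset.mem_insert.1 hq
        · simp only [smul_eq_mul]; ring
        · rw [hwA q hq, hvA q hq, smul_zero, smul_zero, sub_zero]

/-- Here rationality enters: `V_σ` is the common kernel of the integral forms that are sharp on `σ`.
-/
theorem span_latticeOf {Λ : Submodule ℤ V} (hΛ : Submodule.span ℝ (Λ : Set V) = ⊤) {σ : Set V}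
    (hσ : IsRationalPolyhedron Λ σ) (hne : σ.Nonempty) :
    Submodule.span ℝ (latticeOf Λ σ : Set V) = vectorSpan ℝ σ := by
  classical
  refine le_antisymm (Submodule.span_le.2 fun v hv => hv.2) fun v hv => ?_
  obtain ⟨s, hs, rfl⟩ := hσ
  have hmem := fun v => mem_vectorSpan_iff (s := s) hne (v := v)
  have hv' := (hmem v).1 hv
  have := mem_span_of_integral_forms hΛ
    (s.filter fun p => ∀ x ∈ halfSpaces s, p.1 x = p.2)
    (fun p hp => hs p (Finset.mem_filter.1 hp).1) (x := v)
    (fun p hp => hv' p (Finset.mem_filter.1 hp).1 (Finset.mem_filter.1 hp).2)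
  refine Submodule.span_mono ?_ this
  exact fun w hw => ⟨hw.1, (hmem w).2 fun p hp h => hw.2 p (Finset.mem_filter.2 ⟨hp, h⟩)⟩

/-- `N` is the primitive integral normal form of the face `τ` of codimension one of `σ`. -/
structure IsNormal (Λ : Submodule ℤ V) (τ σ : Set V) (N : V →ₗ[ℝ] ℝ) : Prop where
  face : IsFace τ σ
  eq_zero : ∀ v ∈ vectorSpan ℝ τ, N v = 0
  mem : ∀ v ∈ vectorSpan ℝ σ, N v = 0 → v ∈ vectorSpan ℝ τ
  integral : ∀ v ∈ latticeOf Λ σ, ∃ n : ℤ, N v = n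
  exists_one : ∃ v ∈ latticeOf Λ σ, N v = 1
  nonneg : ∀ x ∈ σ, ∀ y ∈ τ, 0 ≤ N (x - y)

theorem exists_sharp_of_ne {s : Finset ((V →ₗ[ℝ] ℝ) × ℝ)} {τ : Set V}
    (h : IsFace τ (halfSpaces s)) (hne : τ ≠ halfSpaces s) :
    ∃ p ∈ s, (∀ y ∈ τ, p.1 y = p.2) ∧ ∃ x ∈ halfSpaces s, p.2 < p.1 x := by
  by_contra hcon
  push Not at hcon
  refine hne (h.subset.antisymm fun x hx => ?_)
  exact mem_of_isExtreme h.1 (h.convex (convex_halfSpaces s)) h.isExtreme hx fun p hp hpτ =>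
    le_antisymm (hcon p hp hpτ x hx) (hx p hp)

/-- A defining form of `σ` that is sharp on `τ` but not on `σ` has kernel `V_τ` in `V_σ` by
dimension. Dividing it by the positive generator of its values on `Λ_σ` makes it primitive and keeps
it non-negative on `σ - τ`. -/
theorem exists_isNormal [FiniteDimensional ℝ V] {Λ : Submodule ℤ V}
    (hΛ : Submodule.span ℝ (Λ : Set V) = ⊤) {τ σ : Set V}
    (hσ : IsRationalPolyhedron Λ σ) (hτσ : IsFace τ σ) (hdim : polyDim τ + 1 = polyDim σ) :
    ∃ N, IsNormal Λ τ σ N := by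
  have hspan := span_latticeOf hΛ hσ (hτσ.1.mono hτσ.subset)
  obtain ⟨s, hs, hσs⟩ := hσ
  change σ = halfSpaces s at hσs
  subst hσs
  obtain ⟨p, hp, hpτ, x₀, hx₀, hpx₀⟩ := exists_sharp_of_ne hτσ (by rintro rfl; omega)
  obtain ⟨y₀, hy₀⟩ := hτσ.1
  have h0 : ∀ v ∈ vectorSpan ℝ τ, p.1 v = 0 := fun v hv => map_eq_zero_of_mem_vectorSpan
    (fun a ha b hb => (hpτ a ha).trans (hpτ b hb).symm) hv
  have hx₀v := sub_mem_vectorSpan hx₀ (hτσ.subset hy₀)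
  have hpos : 0 < p.1 (x₀ - y₀) := by rw [map_sub, hpτ y₀ hy₀]; linarith
  have hker : vectorSpan ℝ τ = vectorSpan ℝ (halfSpaces s) ⊓ LinearMap.ker p.1 := by
    refine Submodule.eq_of_le_of_finrank_le (le_inf hτσ.vectorSpan_le h0) ?_
    have : vectorSpan ℝ (halfSpaces s) ⊓ LinearMap.ker p.1 < vectorSpan ℝ (halfSpaces s) :=
      lt_of_le_of_ne inf_le_left fun he => by
        rw [← he] at hx₀v
        exact hpos.ne' hx₀v.2
    have := Submodule.finrank_lt_finrank_of_lt this
    unfold polyDim at hdim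
    omega
  let I : Ideal ℤ := ((latticeOf Λ (halfSpaces s)).map (p.1.restrictScalars ℤ)).comap
    (Algebra.linearMap ℤ ℝ)
  have hI : ∀ n : ℤ, n ∈ I ↔ ∃ v ∈ latticeOf Λ (halfSpaces s), p.1 v = n := fun n => Iff.rfl
  obtain ⟨d, hd⟩ := (IsPrincipalIdealRing.principal I).principal
  have hd' : ∀ n : ℤ, n ∈ I ↔ d ∣ n := fun n => by rw [hd]; exact Ideal.mem_span_singleton
  -- If all values on `Λ_σ` were zero, the form would vanish on `V_σ`, which `Λ_σ` spans.
  have hd0 : d ≠ 0 := by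
    rintro rfl
    have : vectorSpan ℝ (halfSpaces s) ≤ LinearMap.ker p.1 := by
      rw [← hspan, Submodule.span_le]
      intro v hv
      obtain ⟨n, hn⟩ := hs p hp v hv.1
      have h1 := zero_dvd_iff.1 ((hd' n).1 ((hI n).2 ⟨v, hv, hn⟩))
      rw [h1, Int.cast_zero] at hn
      exact hn
    exact hpos.ne' (this hx₀v)
  have habs : (0 : ℝ) < ((|d| : ℤ) : ℝ) := by exact_mod_cast abs_pos.2 hd0
  refine ⟨(((|d| : ℤ) : ℝ)⁻¹) • p.1, hτσ, fun v hv => ?_, fun v hv hNv => ?_, fun v hv => ?_, ?_,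
    fun x hx y hy => ?_⟩
  · rw [LinearMap.smul_apply, h0 v hv, smul_zero]
  · rw [hker]
    refine ⟨hv, ?_⟩
    rw [LinearMap.smul_apply, smul_eq_mul, mul_eq_zero] at hNv
    exact hNv.resolve_left (inv_ne_zero habs.ne')
  · obtain ⟨n, hn⟩ := hs p hp v hv.1
    obtain ⟨k, hk⟩ := (abs_dvd d n).2 ((hd' n).1 ((hI n).2 ⟨v, hv, hn⟩))
    refine ⟨k, ?_⟩
    rw [LinearMap.smul_apply, smul_eq_mul, hn, hk, Int.cast_mul, ← mul_assoc,
      inv_mul_cancel₀ habs.ne', one_mul]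
  · obtain ⟨v, hv, hpv⟩ := (hI |d|).1 ((hd' _).2 (self_dvd_abs d))
    exact ⟨v, hv, by rw [LinearMap.smul_apply, smul_eq_mul, hpv, inv_mul_cancel₀ habs.ne']⟩
  · rw [LinearMap.smul_apply, smul_eq_mul, map_sub, hpτ y hy]
    exact mul_nonneg (inv_nonneg.2 habs.le) (sub_nonneg.2 (hx p hp))

/-- Generating `Λ_σ` together with `Λ_τ` forces the integer `N v` to divide `1`, and pointing
towards `σ` forces it to be non-negative. Conversely `w - N(w) v ∈ Λ_τ` for all `w ∈ Λ_σ`. -/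
theorem IsNormal.isPrimitive_iff {Λ : Submodule ℤ V} {τ σ : Set V} {N : V →ₗ[ℝ] ℝ}
    (h : IsNormal Λ τ σ N) {v : V} : IsPrimitive Λ τ σ v ↔ v ∈ latticeOf Λ σ ∧ N v = 1 := by
  obtain ⟨y₀, hy₀⟩ := h.face.1
  constructor
  · rintro ⟨hv, ⟨t, ht, x, hx, y, hy, hvt⟩, hspan⟩
    have hvσ : v ∈ latticeOf Λ σ := hspan ▸
      Submodule.mem_sup_left (Submodule.mem_span_singleton_self v)
    refine ⟨hvσ, ?_⟩
    obtain ⟨v₁, hv₁, hN₁⟩ := h.exists_one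
    rw [← hspan, Submodule.mem_sup] at hv₁
    obtain ⟨a, ha, b, hb, rfl⟩ := hv₁
    obtain ⟨n, rfl⟩ := Submodule.mem_span_singleton.1 ha
    obtain ⟨k, hk⟩ := h.integral v hvσ
    rw [map_add, h.eq_zero b hb.2, add_zero, map_zsmul, hk, zsmul_eq_mul] at hN₁
    have hk0 : 0 ≤ N v := by
      rw [← map_smul] at hvt
      have h1 := h.eq_zero _ ((Submodule.Quotient.eq _).1 hvt)
      rw [map_sub, map_smul, sub_eq_zero] at h1
      rw [h1]
      exact mul_nonneg ht (h.nonneg x hx y hy)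
    have h1 : n * k = 1 := by exact_mod_cast hN₁
    have h2 : 0 ≤ k := by rw [hk] at hk0; exact_mod_cast hk0
    rw [hk, Int.eq_one_of_dvd_one h2 ⟨n, by rw [mul_comm]; exact h1.symm⟩, Int.cast_one]
  · rintro ⟨hv, hN⟩
    refine ⟨hv.1, ?_, le_antisymm (sup_le ?_ (latticeOf_mono h.face)) fun w hw => ?_⟩
    · obtain ⟨x, hx, hNx⟩ : ∃ x ∈ σ, N (x - y₀) ≠ 0 := by
        by_contra hcon
        push Not at hcon
        have : N v = 0 := map_eq_zero_of_mem_vectorSpan (fun a ha b hb => by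
          have h1 := hcon a ha
          have h2 := hcon b hb
          rw [map_sub] at h1 h2
          linarith) hv.2
        rw [hN] at this
        exact one_ne_zero this
      have hpos := lt_of_le_of_ne (h.nonneg x hx y₀ hy₀) hNx.symm
      refine ⟨(N (x - y₀))⁻¹, inv_nonneg.2 hpos.le, x, hx, y₀, hy₀, ?_⟩
      rw [← map_smul]
      refine (Submodule.Quotient.eq _).2 (h.mem _ (Submodule.sub_mem _ hv.2
        (Submodule.smul_mem _ _ (sub_mem_vectorSpan hx (h.face.subset hy₀)))) ?_)
      rw [map_sub, map_smul, smul_eq_mul, inv_mul_cancel₀ hNx, hN, sub_self]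
    · rw [Submodule.span_singleton_le_iff_mem]
      exact hv
    · obtain ⟨n, hn⟩ := h.integral w hw
      refine Submodule.mem_sup.2 ⟨n • v, Submodule.smul_mem _ _ (Submodule.mem_span_singleton_self v),
        w - n • v, ⟨Submodule.sub_mem _ hw.1 (Submodule.smul_mem _ _ hv.1), h.mem _ ?_ ?_⟩,
        add_sub_cancel _ _⟩
      · exact (Submodule.sub_mem _ hw (Submodule.smul_mem _ n hv) : w - n • v ∈ latticeOf Λ σ).2
      · rw [map_sub, map_zsmul, hN, hn, zsmul_one, sub_self]

theorem IsNormal.isPrimitive_primVec {Λ : Submodule ℤ V} {τ σ : Set V} {N : V →ₗ[ℝ] ℝ}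
    (h : IsNormal Λ τ σ N) : IsPrimitive Λ τ σ (primVec Λ τ σ) := by
  obtain ⟨v, hv, hN⟩ := h.exists_one
  exact Classical.epsilon_spec ⟨v, h.isPrimitive_iff.2 ⟨hv, hN⟩⟩

theorem IsNormal.sub_mem {Λ : Submodule ℤ V} {τ σ : Set V} {N : V →ₗ[ℝ] ℝ}
    (h : IsNormal Λ τ σ N) {v w : V} (hv : IsPrimitive Λ τ σ v) (hw : IsPrimitive Λ τ σ w) :
    v - w ∈ vectorSpan ℝ τ := by
  rw [h.isPrimitive_iff] at hv hw
  exact h.mem _ (Submodule.sub_mem _ hv.1.2 hw.1.2) (by rw [map_sub, hv.2, hw.2, sub_self])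

theorem mem_latticeOf_quotLattice {Λ : Submodule ℤ V} {τ σ : Set V} (h : IsFace τ σ)
    {p : V ⧸ vectorSpan ℝ τ} : p ∈ latticeOf (quotLattice Λ τ) (starCone τ σ) ↔
      ∃ v ∈ latticeOf Λ σ, (vectorSpan ℝ τ).mkQ v = p := by
  constructor
  · rintro ⟨⟨v, hv, rfl⟩, hp⟩
    exact ⟨v, ⟨hv, (mkQ_mem_vectorSpan_starCone h).1 hp⟩, rfl⟩
  · rintro ⟨v, hv, rfl⟩
    exact ⟨⟨v, hv.1, rfl⟩, (mkQ_mem_vectorSpan_starCone h).2 hv.2⟩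

/-- `N` kills `V_ρ ⊇ V_τ` and so factors through the quotient. The descended form certifies that
images of primitive vectors are primitive. -/
theorem IsNormal.exists_quotient {Λ : Submodule ℤ V} {τ ρ σ : Set V} {N : V →ₗ[ℝ] ℝ}
    (h : IsNormal Λ ρ σ N) (hτρ : IsFace τ ρ) (hτσ : IsFace τ σ) :
    ∃ M, IsNormal (quotLattice Λ τ) (starCone τ ρ) (starCone τ σ) M ∧
      ∀ v, M ((vectorSpan ℝ τ).mkQ v) = N v := by
  obtain ⟨M, hM⟩ := exists_quotient_form (f := N) (τ := τ)
    fun v hv => h.eq_zero v (hτρ.vectorSpan_le hv)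
  refine ⟨M, ⟨isFace_starCone hτρ h.face, ?_, ?_, ?_, ?_, ?_⟩, hM⟩
  · intro p hp
    obtain ⟨v, rfl⟩ := Submodule.mkQ_surjective _ p
    rw [hM]
    exact h.eq_zero v ((mkQ_mem_vectorSpan_starCone hτρ).1 hp)
  · intro p hp hMp
    obtain ⟨v, rfl⟩ := Submodule.mkQ_surjective _ p
    rw [hM] at hMp
    exact (mkQ_mem_vectorSpan_starCone hτρ).2
      (h.mem v ((mkQ_mem_vectorSpan_starCone hτσ).1 hp) hMp)
  · intro p hp
    obtain ⟨v, hv, rfl⟩ := (mem_latticeOf_quotLattice hτσ).1 hp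
    rw [hM]
    exact h.integral v hv
  · obtain ⟨v, hv, hN⟩ := h.exists_one
    exact ⟨_, (mem_latticeOf_quotLattice hτσ).2 ⟨v, hv, rfl⟩, by rw [hM, hN]⟩
  · rintro _ ⟨t, ht, x, hx, y, hy, rfl⟩ _ ⟨t', ht', x', hx', y', hy', rfl⟩
    rw [map_sub, map_smul, map_smul, hM, hM,
      h.eq_zero _ (sub_mem_vectorSpan hx' (hτρ.subset hy')), smul_zero, sub_zero]
    exact mul_nonneg ht (h.nonneg x hx y (hτρ.subset hy))

theorem IsNormal.isPrimitive_mkQ {Λ : Submodule ℤ V} {τ ρ σ : Set V} {N : V →ₗ[ℝ] ℝ}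
    (h : IsNormal Λ ρ σ N) (hτρ : IsFace τ ρ) (hτσ : IsFace τ σ) {v : V}
    (hv : IsPrimitive Λ ρ σ v) :
    IsPrimitive (quotLattice Λ τ) (starCone τ ρ) (starCone τ σ) ((vectorSpan ℝ τ).mkQ v) := by
  obtain ⟨M, hM, hMN⟩ := h.exists_quotient hτρ hτσ
  rw [h.isPrimitive_iff] at hv
  rw [hM.isPrimitive_iff, hMN]
  exact ⟨(mem_latticeOf_quotLattice hτσ).2 ⟨v, hv.1, rfl⟩, hv.2⟩

/-- A rank count: the kernel of `Λ → V / V_τ` has rank at least `dim V_τ`, so the image has rank at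
most `dim V / V_τ`. A `ℤ`-basis of the image spans the quotient over `ℝ`, hence it has exactly that
many elements and is an `ℝ`-basis. -/
theorem isLattice_quotLattice [FiniteDimensional ℝ V] {Λ : Submodule ℤ V} (hΛ : IsLattice Λ)
    {τ : Set V} (hτ : IsRationalPolyhedron Λ τ) (hne : τ.Nonempty) :
    IsLattice (quotLattice Λ τ) := by
  have hspan := span_latticeOf hΛ.span_eq_top hτ hne
  have htop := hΛ.span_eq_top
  obtain ⟨b, hb⟩ := hΛ
  have hfin : Module.Finite ℤ Λ := by rw [hb]; exact Module.Finite.of_basis (b.restrictScalars ℤ)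
  have hrank : Module.finrank ℤ Λ = Module.finrank ℝ V := by
    rw [hb, Module.finrank_eq_card_basis (b.restrictScalars ℤ), Fintype.card_fin]
  set f : Λ →ₗ[ℤ] V ⧸ vectorSpan ℝ τ := ((vectorSpan ℝ τ).mkQ.restrictScalars ℤ).domRestrict Λ
  have hrange : LinearMap.range f = quotLattice Λ τ := LinearMap.range_domRestrict _ _
  have hrn := (LinearMap.ker f).finrank_quotient_add_finrank
  rw [f.quotKerEquivRange.finrank_eq, hrange, hrank] at hrn
  have hfin' : Module.Finite ℤ (quotLattice Λ τ) := by rw [← hrange]; infer_instance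
  -- As `τ` is rational, `V_τ` has an `ℝ`-basis of vectors of `Λ_τ`, and these are independent over
  -- `ℤ`.
  have hker : Module.finrank ℝ (vectorSpan ℝ τ) ≤ Module.finrank ℤ (LinearMap.ker f) := by
    obtain ⟨w, hw, -, hli⟩ := Submodule.exists_fun_fin_finrank_span_eq ℝ (latticeOf Λ τ : Set V)
    have hfr : Module.finrank ℝ (Submodule.span ℝ (latticeOf Λ τ : Set V)) =
      Module.finrank ℝ (vectorSpan ℝ τ) := by rw [hspan]
    let w' : Fin (Module.finrank ℝ (Submodule.span ℝ (latticeOf Λ τ : Set V))) → LinearMap.ker f := fun i =>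
      ⟨⟨w i, (hw i).1⟩, (Submodule.Quotient.mk_eq_zero _).2 (hw i).2⟩
    have h1 : LinearIndependent ℤ w := hli.restrict_scalars (by
      intro m n hmn
      simpa using hmn)
    have h2 : LinearIndependent ℤ w' :=
      LinearIndependent.of_comp (Λ.subtype ∘ₗ (LinearMap.ker f).subtype) h1
    simpa [← hfr] using h2.fintype_card_le_finrank
  have hq := (vectorSpan ℝ τ).finrank_quotient_add_finrank
  have htf : Module.IsTorsionFree ℤ (V ⧸ vectorSpan ℝ τ) :=
    .trans_faithfulSMul ℤ ℝ _
  have hfree : Module.Free ℤ (quotLattice Λ τ) := inferInstance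
  let B := Module.finBasis ℤ (quotLattice Λ τ)
  have hspanB : Submodule.span ℤ (Set.range fun i => (B i : V ⧸ vectorSpan ℝ τ)) =
      quotLattice Λ τ := by
    have := congrArg (Submodule.map (quotLattice Λ τ).subtype) B.span_eq
    rw [Submodule.map_span, Submodule.map_top, Submodule.range_subtype, ← Set.range_comp] at this
    exact this
  have hspanR : Submodule.span ℝ (Set.range fun i => (B i : V ⧸ vectorSpan ℝ τ)) = ⊤ := by
    rw [eq_top_iff, ← Submodule.range_mkQ (vectorSpan ℝ τ), ← Submodule.map_top, ← htop,
      Submodule.map_span, Submodule.span_le]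
    rintro _ ⟨v, hv, rfl⟩
    have h1 : (vectorSpan ℝ τ).mkQ v ∈ quotLattice Λ τ := ⟨v, hv, rfl⟩
    rw [← hspanB] at h1
    exact Submodule.span_le_restrictScalars ℤ ℝ _ h1
  have hle := finrank_range_le_card (R := ℝ) fun i => (B i : V ⧸ vectorSpan ℝ τ)
  rw [Set.finrank, hspanR, finrank_top, Fintype.card_fin] at hle
  have hcard : Module.finrank ℤ (quotLattice Λ τ) = Module.finrank ℝ (V ⧸ vectorSpan ℝ τ) := by
    omega
  refine ⟨(basisOfTopLeSpanOfCardEqFinrank _ hspanR.ge (by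
    rw [Fintype.card_fin, hcard])).reindex (finCongr hcard), ?_⟩
  rw [Module.Basis.range_reindex, coe_basisOfTopLeSpanOfCardEqFinrank, hspanB]

/-- The projection to `V / V_τ` has a section that maps lattice vectors to lattice vectors. -/
theorem exists_integral_section {Λ : Submodule ℤ V} {τ : Set V}
    (h : IsLattice (quotLattice Λ τ)) : ∃ s : (V ⧸ vectorSpan ℝ τ) →ₗ[ℝ] V,
      (∀ p, (vectorSpan ℝ τ).mkQ (s p) = p) ∧ ∀ p ∈ quotLattice Λ τ, s p ∈ Λ := by
  obtain ⟨b, hb⟩ := h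
  have hbi : ∀ i, ∃ v ∈ Λ, (vectorSpan ℝ τ).mkQ v = b i := fun i => by
    have : b i ∈ quotLattice Λ τ := hb ▸ Submodule.subset_span ⟨i, rfl⟩
    exact this
  choose v hv hvb using hbi
  refine ⟨b.constr ℝ v, fun p => ?_, fun p hp => ?_⟩
  · have : (vectorSpan ℝ τ).mkQ ∘ₗ b.constr ℝ v = LinearMap.id :=
      b.ext fun i => by rw [LinearMap.comp_apply, b.constr_basis, hvb, LinearMap.id_apply]
    exact LinearMap.congr_fun this p
  · have : quotLattice Λ τ ≤ Λ.comap ((b.constr ℝ v).restrictScalars ℤ) := by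
      rw [hb, Submodule.span_le]
      rintro _ ⟨i, rfl⟩
      change b.constr ℝ v (b i) ∈ Λ
      rw [b.constr_basis]
      exact hv i
    exact this hp

/-! ### Faces of codimension one and two -/

theorem IsFace.isRationalPolyhedron {Λ : Submodule ℤ V} {τ σ : Set V}
    (hσ : IsRationalPolyhedron Λ σ) (h : IsFace τ σ) : IsRationalPolyhedron Λ τ := by
  classical
  obtain ⟨s, hs, hσs⟩ := hσ
  change σ = halfSpaces s at hσs
  subst hσs
  refine ⟨s ∪ (s.filter fun p => ∀ y ∈ τ, p.1 y = p.2).image fun p => (-p.1, -p.2), ?_, ?_⟩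
  · intro p hp v hv
    rcases Finset.mem_union.1 hp with hp | hp
    · exact hs p hp v hv
    · obtain ⟨q, hq, rfl⟩ := Finset.mem_image.1 hp
      obtain ⟨n, hn⟩ := hs q (Finset.mem_filter.1 hq).1 v hv
      exact ⟨-n, by simp [hn]⟩
  · ext x
    constructor
    · intro hx p hp
      rcases Finset.mem_union.1 hp with hp | hp
      · exact h.subset hx p hp
      · obtain ⟨q, hq, rfl⟩ := Finset.mem_image.1 hp
        exact (neg_le_neg ((Finset.mem_filter.1 hq).2 x hx).le)
    · intro hx
      have hxs : x ∈ halfSpaces s := fun p hp => hx p (Finset.mem_union_left _ hp)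
      refine mem_of_isExtreme h.1 (h.convex (convex_halfSpaces s)) h.isExtreme hxs
        fun p hp hpτ => le_antisymm ?_ (hxs p hp)
      exact neg_le_neg_iff.1 (hx (-p.1, -p.2) (Finset.mem_union_right _
        (Finset.mem_image_of_mem _ (Finset.mem_filter.2 ⟨hp, hpτ⟩))))

theorem IsFace.exists_isRelInt {Λ : Submodule ℤ V} {τ σ : Set V}
    (hσ : IsRationalPolyhedron Λ σ) (h : IsFace τ σ) : ∃ y, IsRelInt τ y :=
  (h.isRationalPolyhedron hσ).exists_isRelInt h.1

theorem IsFace.mem_of_sub_mem {τ σ : Set V} (h : IsFace τ σ) {x y : V} (hx : x ∈ σ) (hy : y ∈ τ)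
    (hxy : x - y ∈ vectorSpan ℝ τ) : x ∈ τ := by
  obtain ⟨f, c, -, hf⟩ := h.exists_form
  have hc : ∀ z ∈ τ, f z = c := fun z hz => (hf z (h.subset hz)).1 hz
  have h1 := map_eq_zero_of_mem_vectorSpan (f := f)
    (fun a ha b hb => (hc a ha).trans (hc b hb).symm) hxy
  rw [map_sub, hc y hy, sub_eq_zero] at h1
  exact (hf x hx).2 h1

theorem IsFace.eq_of_isRelInt_mem {τ σ : Set V} (h : IsFace τ σ) {z : V} (hz : IsRelInt σ z)
    (hzτ : z ∈ τ) : τ = σ := by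
  obtain ⟨f, c, hle, hf⟩ := h.exists_form
  exact h.subset.antisymm fun x hx =>
    (hf x hx).2 (hz.eq_of_le hle ((hf z hz.1).1 hzτ) x hx)

theorem IsFace.subset_of_isRelInt_mem {τ ρ σ : Set V} (h : IsFace τ σ) (hρ : ρ ⊆ σ) {z : V}
    (hz : IsRelInt ρ z) (hzτ : z ∈ τ) : ρ ⊆ τ := by
  obtain ⟨f, c, hle, hf⟩ := h.exists_form
  exact fun x hx => (hf x (hρ hx)).2
    (hz.eq_of_le (fun y hy => hle y (hρ hy)) ((hf z (hρ hz.1)).1 hzτ) x hx)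

/-- Stepping from `y₀` along `v` stays in the polyhedron and keeps all inequalities sharp on `τ`
sharp, so it stays in `τ`. -/
theorem mem_vectorSpan_of_face {s : Finset ((V →ₗ[ℝ] ℝ) × ℝ)} {τ : Set V}
    (h : IsFace τ (halfSpaces s)) {y₀ : V} (hy₀ : IsRelInt τ y₀) {v : V}
    (hv : ∀ p ∈ s, (∀ y ∈ τ, p.1 y = p.2) → p.1 v = 0) : v ∈ vectorSpan ℝ τ := by
  obtain ⟨ε, hε, hstep⟩ := exists_step s (h.subset hy₀.1) (w := v) fun p hp hpy =>
    (hv p hp (hy₀.eq_of_le (fun x hx => h.subset hx p hp) hpy)).ge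
  have h1 : y₀ + ε • v ∈ τ := by
    refine mem_of_isExtreme h.1 (h.convex (convex_halfSpaces s)) h.isExtreme
      (hstep ε hε.le le_rfl) fun p hp hpτ => ?_
    rw [map_add, map_smul, hv p hp hpτ, smul_zero, add_zero, hpτ y₀ hy₀.1]
  have := sub_mem_vectorSpan h1 hy₀.1
  rw [add_sub_cancel_left] at this
  exact (Submodule.smul_mem_iff _ hε.ne').1 this

/-- A ray starting inside a cone and not contained in it leaves the cone through a wall. -/
theorem exists_exit (A : Finset ((V →ₗ[ℝ] ℝ) × ℝ)) {w u : V} (hw : ∀ p ∈ A, 0 ≤ p.1 w)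
    (hwu : ∀ p ∈ A, p.1 u < 0 → 0 < p.1 w) (hu : ∃ p ∈ A, p.1 u < 0) :
    ∃ t : ℝ, 0 < t ∧ (∀ p ∈ A, 0 ≤ p.1 (w + t • u)) ∧
      ∃ p ∈ A, p.1 u < 0 ∧ p.1 (w + t • u) = 0 := by
  classical
  obtain ⟨q, hq, hqu⟩ := hu
  -- The ray meets the wall of `p` at time `p(w) / (-p(u))`; the smallest of these times is the
  -- exit.
  obtain ⟨p, hp, hmin⟩ := Finset.exists_min_image (A.filter fun p => p.1 u < 0)
    (fun p => p.1 w / (-p.1 u)) ⟨q, Finset.mem_filter.2 ⟨hq, hqu⟩⟩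
  obtain ⟨hpA, hpu⟩ := Finset.mem_filter.1 hp
  have hpu' : 0 < -p.1 u := by linarith
  have ht : 0 < p.1 w / (-p.1 u) := div_pos (hwu p hpA hpu) hpu'
  refine ⟨p.1 w / (-p.1 u), ht, fun r hr => ?_, p, hpA, hpu, ?_⟩
  · rw [map_add, map_smul, smul_eq_mul]
    by_cases hru : r.1 u < 0
    · have h1 := hmin r (Finset.mem_filter.2 ⟨hr, hru⟩)
      rw [le_div_iff₀ (by linarith)] at h1
      linarith
    · have := mul_nonneg ht.le (not_lt.1 hru)
      have := hw r hr
      linarith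
  · rw [map_add, map_smul, smul_eq_mul]
    have : p.1 w / (-p.1 u) * (-p.1 u) = p.1 w := div_mul_cancel₀ _ hpu'.ne'
    linarith

theorem exists_sub_smul_mem [FiniteDimensional ℝ V] {U W : Submodule ℝ V} (hUW : U ≤ W)
    (hd : Module.finrank ℝ U + 1 = Module.finrank ℝ W) {r : V} (hr : r ∈ W) (hrU : r ∉ U)
    {w : V} (hw : w ∈ W) : ∃ a : ℝ, w - a • r ∈ U := by
  have h1 : U ⊔ Submodule.span ℝ {r} = W := by
    refine Submodule.eq_of_le_of_finrank_le
      (sup_le hUW ((Submodule.span_singleton_le_iff_mem _ _).2 hr)) ?_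
    have : U < U ⊔ Submodule.span ℝ {r} := lt_of_le_of_ne le_sup_left fun he =>
      hrU (he ▸ Submodule.mem_sup_right (Submodule.mem_span_singleton_self r))
    have := Submodule.finrank_lt_finrank_of_lt this
    omega
  rw [← h1, Submodule.mem_sup] at hw
  obtain ⟨u, hu, v, hv, rfl⟩ := hw
  obtain ⟨a, rfl⟩ := Submodule.mem_span_singleton.1 hv
  exact ⟨a, by rwa [add_sub_cancel_right]⟩

/-- A wall through which a direction at `τ` points determines a face containing `τ` and that
direction. -/
theorem isFace_wall {s : Finset ((V →ₗ[ℝ] ℝ) × ℝ)} {τ : Set V} (h : IsFace τ (halfSpaces s))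
    {p : (V →ₗ[ℝ] ℝ) × ℝ} (hp : p ∈ s) (hpτ : ∀ y ∈ τ, p.1 y = p.2) :
    IsFace {x | x ∈ halfSpaces s ∧ p.1 x = p.2} (halfSpaces s) ∧
      IsFace τ {x | x ∈ halfSpaces s ∧ p.1 x = p.2} := by
  obtain ⟨y, hy⟩ := h.1
  have h1 := isFace_of_sharp hp (h.subset hy) (hpτ y hy)
  exact ⟨h1, h.of_subset (fun z hz => ⟨h.subset hz, hpτ z hz⟩) h1.subset⟩

theorem exists_add_smul_mem_wall {s : Finset ((V →ₗ[ℝ] ℝ) × ℝ)} {τ : Set V}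
    (h : IsFace τ (halfSpaces s)) {y₀ : V} (hy₀ : IsRelInt τ y₀) {w : V}
    (hw : ∀ p ∈ s, (∀ y ∈ τ, p.1 y = p.2) → 0 ≤ p.1 w) :
    ∃ ε : ℝ, 0 < ε ∧ y₀ + ε • w ∈ halfSpaces s := by
  obtain ⟨ε, hε, hstep⟩ := exists_step s (h.subset hy₀.1) (w := w) fun p hp hpy =>
    hw p hp (hy₀.eq_of_le (fun x hx => h.subset hx p hp) hpy)
  exact ⟨ε, hε, hstep ε hε.le le_rfl⟩

/-- Start at an interior direction `w` of the cone at `τ` and move along some `u ∈ V_σ` outside `V_τ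
+ ℝ w` until a wall is hit. The face of that wall is not `τ`, as the exit direction is not in `V_τ`,
and not `σ`, as the form of the wall is strict at `x₀`. -/
theorem exists_intermediate_face [FiniteDimensional ℝ V] {Λ : Submodule ℤ V} {τ σ : Set V}
    (hσ : IsRationalPolyhedron Λ σ) (h : IsFace τ σ) (hd : polyDim τ + 1 < polyDim σ) :
    ∃ ρ, IsFace τ ρ ∧ IsFace ρ σ ∧ τ ≠ ρ ∧ ρ ≠ σ := by
  classical
  obtain ⟨y₀, hy₀⟩ := h.exists_isRelInt hσ
  obtain ⟨x₀, hx₀⟩ := hσ.exists_isRelInt (h.1.mono h.subset)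
  obtain ⟨s, hs, hσs⟩ := hσ
  change σ = halfSpaces s at hσs
  subst hσs
  set A := s.filter fun p => ∀ y ∈ τ, p.1 y = p.2 with hA
  have hmemA : ∀ p, p ∈ A ↔ p ∈ s ∧ ∀ y ∈ τ, p.1 y = p.2 := fun p => Finset.mem_filter
  set w := x₀ - y₀ with hw
  have hwσ : w ∈ vectorSpan ℝ (halfSpaces s) := sub_mem_vectorSpan hx₀.1 (h.subset hy₀.1)
  obtain ⟨u, hu, huU⟩ : ∃ u ∈ vectorSpan ℝ (halfSpaces s),
      u ∉ vectorSpan ℝ τ ⊔ Submodule.span ℝ {w} := by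
    by_contra hcon
    push Not at hcon
    have h1 := Submodule.finrank_mono (R := ℝ) (M := V)
      (show vectorSpan ℝ (halfSpaces s) ≤ vectorSpan ℝ τ ⊔ Submodule.span ℝ {w} from hcon)
    have h2 := Submodule.finrank_add_le_finrank_add_finrank (vectorSpan ℝ τ)
      (Submodule.span ℝ {w})
    have h3 := finrank_span_le_card (R := ℝ) ({w} : Set V)
    rw [Set.toFinset_singleton, Finset.card_singleton] at h3
    unfold polyDim at hd
    omega
  have hwA : ∀ p ∈ A, p.1 w = p.1 x₀ - p.2 := fun p hp => by
    rw [hw, map_sub, ((hmemA p).1 hp).2 y₀ hy₀.1]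
  have hwA0 : ∀ p ∈ A, 0 ≤ p.1 w := fun p hp => by
    rw [hwA p hp]; exact sub_nonneg.2 (hx₀.1 p ((hmemA p).1 hp).1)
  have hwA1 : ∀ v ∈ vectorSpan ℝ (halfSpaces s), ∀ p ∈ A, p.1 v ≠ 0 → 0 < p.1 w := by
    intro v hv p hp hpv
    refine lt_of_le_of_ne (hwA0 p hp) fun h0 => hpv ?_
    rw [hwA p hp] at h0
    have h1 := hx₀.eq_of_le (f := p.1) (c := p.2) (fun x hx => hx p ((hmemA p).1 hp).1)
      (by linarith)
    exact map_eq_zero_of_mem_vectorSpan (fun a ha b hb => (h1 a ha).trans (h1 b hb).symm) hv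
  -- Either `u` or `-u` points out of the cone: otherwise all forms sharp on `τ` vanish at `u`, so
  -- that `u ∈ V_τ`.
  obtain ⟨u, hu, huU, hneg⟩ : ∃ u ∈ vectorSpan ℝ (halfSpaces s),
      u ∉ vectorSpan ℝ τ ⊔ Submodule.span ℝ {w} ∧ ∃ p ∈ A, p.1 u < 0 := by
    by_cases hneg : ∃ p ∈ A, p.1 u < 0
    · exact ⟨u, hu, huU, hneg⟩
    · refine ⟨-u, Submodule.neg_mem _ hu, fun hc => huU ((Submodule.neg_mem_iff _).1 hc), ?_⟩
      by_contra hpos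
      push Not at hneg hpos
      refine huU (Submodule.mem_sup_left (mem_vectorSpan_of_face h hy₀ fun p hp hpτ => ?_))
      have h1 := hneg p ((hmemA p).2 ⟨hp, hpτ⟩)
      have h2 := hpos p ((hmemA p).2 ⟨hp, hpτ⟩)
      rw [map_neg] at h2
      linarith
  obtain ⟨t, ht, hpos, p, hp, hpu, hp0⟩ := exists_exit A hwA0
    (fun p hp hpu => hwA1 u hu p hp hpu.ne) hneg
  have hp' := (hmemA p).1 hp
  obtain ⟨h1, h2⟩ := isFace_wall h hp'.1 hp'.2
  refine ⟨_, h2, h1, fun he => huU ?_, fun he => ?_⟩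
  · obtain ⟨ε, hε, hstep⟩ := exists_add_smul_mem_wall h hy₀ (w := w + t • u)
      fun q hq hqτ => hpos q ((hmemA q).2 ⟨hq, hqτ⟩)
    have h3 : y₀ + ε • (w + t • u) ∈ τ := by
      rw [he]
      exact ⟨hstep, by rw [map_add, map_smul, hp0, smul_zero, add_zero, hp'.2 y₀ hy₀.1]⟩
    have h4 := sub_mem_vectorSpan h3 hy₀.1
    rw [add_sub_cancel_left] at h4
    have h5 := (Submodule.smul_mem_iff _ hε.ne').1 h4
    have h6 : t • u ∈ vectorSpan ℝ τ ⊔ Submodule.span ℝ {w} := by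
      have := Submodule.sub_mem _ (Submodule.mem_sup_left (T := Submodule.span ℝ {w}) h5)
        (Submodule.mem_sup_right (Submodule.mem_span_singleton_self w))
      rwa [add_sub_cancel_left] at this
    exact (Submodule.smul_mem_iff _ ht.ne').1 h6
  · have h3 : x₀ ∈ {x | x ∈ halfSpaces s ∧ p.1 x = p.2} := by rw [he]; exact hx₀.1
    have h4 := hwA1 u hu p hp hpu.ne
    rw [hwA p hp, h3.2, sub_self] at h4
    exact lt_irrefl _ h4

/-- Every proper face is contained in a face of codimension one. -/
theorem exists_ridge_face [FiniteDimensional ℝ V] {Λ : Submodule ℤ V} {τ σ : Set V}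
    (hσ : IsRationalPolyhedron Λ σ) (h : IsFace τ σ) (hne : τ ≠ σ) :
    ∃ ρ, IsFace τ ρ ∧ IsFace ρ σ ∧ polyDim ρ + 1 = polyDim σ := by
  induction hn : polyDim σ - polyDim τ using Nat.strong_induction_on generalizing τ with
  | _ n ih =>
    have hlt := h.polyDim_lt hne
    by_cases hd : polyDim τ + 1 = polyDim σ
    · exact ⟨τ, isFace_refl h.1, h, hd⟩
    · obtain ⟨ρ, h1, h2, h3, h4⟩ := exists_intermediate_face hσ h (by omega)
      have := h1.polyDim_lt h3
      have := h2.polyDim_lt h4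
      obtain ⟨ρ', h5, h6, h7⟩ := ih _ (by omega) h2 h4 rfl
      exact ⟨ρ', h1.trans (h6.isRationalPolyhedron hσ) h5, h6, h7⟩

/-- A face of codimension two is contained in exactly two faces of codimension one. -/
theorem exists_two_ridges [FiniteDimensional ℝ V] {Λ : Submodule ℤ V} {τ σ : Set V}
    (hσ : IsRationalPolyhedron Λ σ) (h : IsFace τ σ) (hd : polyDim τ + 2 = polyDim σ) :
    ∃ ρ₁ ρ₂, ρ₁ ≠ ρ₂ ∧ ∀ ρ, (IsFace τ ρ ∧ IsFace ρ σ ∧ polyDim ρ + 1 = polyDim σ) ↔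
      (ρ = ρ₁ ∨ ρ = ρ₂) := by
  classical
  obtain ⟨ρ₁, hτ₁, h₁σ, hd₁⟩ := exists_ridge_face hσ h (by rintro rfl; omega)
  have hτne : τ ≠ ρ₁ := by rintro rfl; omega
  have hσ' := hσ
  obtain ⟨y₀, hy₀⟩ := h.exists_isRelInt hσ
  obtain ⟨z₁, hz₁⟩ := h₁σ.exists_isRelInt hσ
  obtain ⟨x₀, hx₀⟩ := hσ.exists_isRelInt (h.1.mono h.subset)
  obtain ⟨s, hs, hσs⟩ := hσ
  change σ = halfSpaces s at hσs
  subst hσs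
  set A := s.filter fun p => ∀ y ∈ τ, p.1 y = p.2 with hA
  have hmemA : ∀ p, p ∈ A ↔ p ∈ s ∧ ∀ y ∈ τ, p.1 y = p.2 := fun p => Finset.mem_filter
  have hsub : ∀ p ∈ A, ∀ x, p.1 (x - y₀) = p.1 x - p.2 := fun p hp x => by
    rw [map_sub, ((hmemA p).1 hp).2 y₀ hy₀.1]
  have hnn : ∀ p ∈ A, ∀ x ∈ halfSpaces s, 0 ≤ p.1 (x - y₀) := fun p hp x hx => by
    rw [hsub p hp]; exact sub_nonneg.2 (hx p ((hmemA p).1 hp).1)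
  have hr₁ : z₁ - y₀ ∉ vectorSpan ℝ τ := fun hc =>
    hτne (hτ₁.eq_of_isRelInt_mem hz₁ (hτ₁.mem_of_sub_mem hz₁.1 hy₀.1 hc))
  have hz₁s := h₁σ.subset hz₁.1
  have hex : ∃ p ∈ A, p.1 (-(z₁ - y₀)) < 0 := by
    by_contra hcon
    push Not at hcon
    refine hr₁ (mem_vectorSpan_of_face h hy₀ fun p hp hpτ => ?_)
    have h1 := hcon p ((hmemA p).2 ⟨hp, hpτ⟩)
    rw [map_neg] at h1
    have h2 := hnn p ((hmemA p).2 ⟨hp, hpτ⟩) z₁ hz₁s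
    linarith
  -- The second ridge is found opposite to the first: moving from an interior direction away from
  -- `z₁ - y₀`, the cone is left through the wall of `p₂`, in the direction `r₂`.
  obtain ⟨t, ht, hpos, p₂, hp₂, hpu₂, hp₂0⟩ := exists_exit A (w := x₀ - y₀)
    (fun p hp => hnn p hp x₀ hx₀.1) (fun p hp hpu => by
      refine lt_of_le_of_ne (hnn p hp x₀ hx₀.1) fun h0 => ?_
      rw [hsub p hp] at h0
      have h1 := hx₀.eq_of_le (f := p.1) (c := p.2) (fun x hx => hx p ((hmemA p).1 hp).1)
        (by linarith)
      rw [map_neg, hsub p hp, h1 z₁ hz₁s] at hpu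
      simp at hpu) hex
  set r₂ := (x₀ - y₀) + t • (-(z₁ - y₀)) with hr₂
  have hp₂' := (hmemA p₂).1 hp₂
  obtain ⟨h₂σ, hτ₂⟩ := isFace_wall h hp₂'.1 hp₂'.2
  set ρ₂ : Set V := {x | x ∈ halfSpaces s ∧ p₂.1 x = p₂.2} with hρ₂
  have hr₂₁ : r₂ ∉ vectorSpan ℝ ρ₁ := by
    intro hc
    have h1 : x₀ - y₀ ∈ vectorSpan ℝ ρ₁ := by
      have h2 := Submodule.add_mem _ hc (Submodule.smul_mem _ t
        (sub_mem_vectorSpan hz₁.1 (hτ₁.subset hy₀.1)))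
      rwa [hr₂, smul_neg, neg_add_cancel_right] at h2
    have h3 := h₁σ.eq_of_isRelInt_mem hx₀ (h₁σ.mem_of_sub_mem hx₀.1 (hτ₁.subset hy₀.1) h1)
    rw [h3] at hd₁
    omega
  obtain ⟨ε, hε, hstep⟩ := exists_add_smul_mem_wall h hy₀ (w := r₂)
    fun q hq hqτ => hpos q ((hmemA q).2 ⟨hq, hqτ⟩)
  have hmem₂ : y₀ + ε • r₂ ∈ ρ₂ :=
    ⟨hstep, by rw [map_add, map_smul, hp₂0, smul_zero, add_zero, hp₂'.2 y₀ hy₀.1]⟩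
  have hr₂₂ : r₂ ∈ vectorSpan ℝ ρ₂ := by
    have h4 := sub_mem_vectorSpan hmem₂ (hτ₂.subset hy₀.1)
    rw [add_sub_cancel_left] at h4
    exact (Submodule.smul_mem_iff _ hε.ne').1 h4
  have hp₂z₁ : 0 < p₂.1 (z₁ - y₀) := by rw [map_neg] at hpu₂; linarith
  have hz₁₂ : z₁ ∉ ρ₂ := fun hc => by
    rw [hsub p₂ hp₂, hc.2, sub_self] at hp₂z₁
    exact lt_irrefl _ hp₂z₁
  have hne₂σ : ρ₂ ≠ halfSpaces s := fun he => hz₁₂ (he ▸ hz₁s)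
  have hneτ₂ : τ ≠ ρ₂ := fun he => hr₂₁ (hτ₁.vectorSpan_le (he ▸ hr₂₂))
  have hd₂ : polyDim ρ₂ + 1 = polyDim (halfSpaces s) := by
    have := hτ₂.polyDim_lt hneτ₂
    have := h₂σ.polyDim_lt hne₂σ
    omega
  refine ⟨ρ₁, ρ₂, fun he => hz₁₂ (he ▸ hz₁.1), fun ρ => ⟨?_, ?_⟩⟩
  swap
  · rintro (rfl | rfl)
    · exact ⟨hτ₁, h₁σ, hd₁⟩
    · exact ⟨hτ₂, h₂σ, hd₂⟩
  rintro ⟨hτρ, hρσ, hdρ⟩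
  obtain ⟨z, hz⟩ := hρσ.exists_isRelInt hσ'
  have hfin : ∀ ρ', IsFace τ ρ' → IsFace ρ' (halfSpaces s) →
      polyDim ρ' + 1 = polyDim (halfSpaces s) → z - y₀ ∈ vectorSpan ℝ ρ' → ρ = ρ' := by
    intro ρ' h1 h2 h3 h4
    have h5 := h2.mem_of_sub_mem (hρσ.subset hz.1) (h1.subset hy₀.1) h4
    have h6 := h2.subset_of_isRelInt_mem hρσ.subset hz h5
    exact (hρσ.of_subset h6 h2.subset).eq_of_polyDim_le (by omega)
  obtain ⟨b, hb⟩ := exists_sub_smul_mem h₁σ.vectorSpan_le hd₁ (h₂σ.vectorSpan_le hr₂₂) hr₂₁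
    (sub_mem_vectorSpan (hρσ.subset hz.1) (h.subset hy₀.1))
  obtain ⟨a, ha⟩ := exists_sub_smul_mem hτ₁.vectorSpan_le
    (show polyDim τ + 1 = polyDim ρ₁ by omega)
    (sub_mem_vectorSpan hz₁.1 (hτ₁.subset hy₀.1)) hr₁ hb
  by_cases hb0 : b = 0
  · left
    refine hfin ρ₁ hτ₁ h₁σ hd₁ ?_
    rwa [hb0, zero_smul, sub_zero] at hb
  by_cases ha0 : a = 0
  · right
    refine hfin ρ₂ hτ₂ h₂σ hd₂ ?_
    rw [ha0, zero_smul, sub_zero] at ha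
    have := Submodule.add_mem _ (hτ₂.vectorSpan_le ha) (Submodule.smul_mem _ b hr₂₂)
    rwa [sub_add_cancel] at this
  -- A third ridge would contain a direction `b r₂ + a (z₁ - y₀)` modulo `V_τ` with `a, b > 0`, as
  -- the wall forms `p₂` and `p₁` show. The form exposing it is non-negative on both edges and zero
  -- on this sum, so it vanishes on `V_σ` and the ridge is all of `σ`.
  exfalso
  have hval : ∀ f : V →ₗ[ℝ] ℝ, (∀ v ∈ vectorSpan ℝ τ, f v = 0) →
      f (z - y₀) = b * f r₂ + a * f (z₁ - y₀) := fun f hf => by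
    have h1 := hf _ ha
    simp only [map_sub, map_smul, smul_eq_mul] at h1 ⊢
    linarith
  have hAτ : ∀ p ∈ A, ∀ v ∈ vectorSpan ℝ τ, p.1 v = 0 := fun p hp v hv =>
    map_eq_zero_of_mem_vectorSpan (fun x hx y hy =>
      (((hmemA p).1 hp).2 x hx).trans (((hmemA p).1 hp).2 y hy).symm) hv
  have hspan : ∀ f : V →ₗ[ℝ] ℝ, (∀ v ∈ vectorSpan ℝ τ, f v = 0) → f r₂ = 0 → f (z₁ - y₀) = 0 →
      ∀ v ∈ vectorSpan ℝ (halfSpaces s), f v = 0 := by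
    intro f h1 h2 h3 v hv
    obtain ⟨b', hb'⟩ := exists_sub_smul_mem h₁σ.vectorSpan_le hd₁ (h₂σ.vectorSpan_le hr₂₂) hr₂₁ hv
    obtain ⟨a', ha'⟩ := exists_sub_smul_mem hτ₁.vectorSpan_le
      (show polyDim τ + 1 = polyDim ρ₁ by omega)
      (sub_mem_vectorSpan hz₁.1 (hτ₁.subset hy₀.1)) hr₁ hb'
    have h4 := h1 _ ha'
    rw [map_sub, map_sub, map_smul, map_smul, h2, h3, smul_zero, smul_zero, sub_zero,
      sub_zero] at h4
    exact h4
  have hapos : 0 < a := by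
    refine lt_of_le_of_ne ?_ (Ne.symm ha0)
    have h1 := hnn p₂ hp₂ z (hρσ.subset hz.1)
    rw [hval p₂.1 (hAτ p₂ hp₂), hp₂0, mul_zero, zero_add] at h1
    exact nonneg_of_mul_nonneg_left h1 hp₂z₁
  have hbpos : 0 < b := by
    refine lt_of_le_of_ne ?_ (Ne.symm hb0)
    obtain ⟨p₁, hp₁, hp₁ρ, x, hx, hpx⟩ := exists_sharp_of_ne h₁σ (by rintro rfl; omega)
    have hp₁A : p₁ ∈ A := (hmemA p₁).2 ⟨hp₁, fun y hy => hp₁ρ y (hτ₁.subset hy)⟩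
    have hp₁z₁ : p₁.1 (z₁ - y₀) = 0 := by rw [hsub p₁ hp₁A, hp₁ρ z₁ hz₁.1, sub_self]
    have h1 := hnn p₁ hp₁A z (hρσ.subset hz.1)
    rw [hval p₁.1 (hAτ p₁ hp₁A), hp₁z₁, mul_zero, add_zero] at h1
    refine nonneg_of_mul_nonneg_left h1 (lt_of_le_of_ne (hpos p₁ hp₁A) fun h0 => ?_)
    have h2 := hspan p₁.1 (hAτ p₁ hp₁A) h0.symm hp₁z₁ (x - y₀)
      (sub_mem_vectorSpan hx (h.subset hy₀.1))
    rw [hsub p₁ hp₁A] at h2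
    linarith
  obtain ⟨f, c, hle, hf⟩ := hρσ.exists_form
  have hfτ : ∀ y ∈ τ, f y = c := fun y hy => (hf y (h.subset hy)).1 (hτρ.subset hy)
  have hfτ0 : ∀ v ∈ vectorSpan ℝ τ, f v = 0 := fun v hv =>
    map_eq_zero_of_mem_vectorSpan (fun x hx y hy => (hfτ x hx).trans (hfτ y hy).symm) hv
  have h1 := hval f hfτ0
  rw [map_sub, (hf z (hρσ.subset hz.1)).1 hz.1, hfτ y₀ hy₀.1, sub_self] at h1
  have h2 : 0 ≤ f (z₁ - y₀) := by
    rw [map_sub, hfτ y₀ hy₀.1]; exact sub_nonneg.2 (hle _ hz₁s)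
  have h3 : 0 ≤ f r₂ := by
    have := hle _ hstep
    rw [map_add, map_smul, hfτ y₀ hy₀.1, smul_eq_mul] at this
    exact nonneg_of_mul_nonneg_right (by linarith : 0 ≤ ε * f r₂) hε
  have h4 := mul_nonneg hbpos.le h3
  have h5 := mul_nonneg hapos.le h2
  have h6 : f r₂ = 0 := (mul_eq_zero.1 (by linarith : b * f r₂ = 0)).resolve_left hb0
  have h7 : f (z₁ - y₀) = 0 := (mul_eq_zero.1 (by linarith : a * f (z₁ - y₀) = 0)).resolve_left ha0
  have h8 : ρ = halfSpaces s := hρσ.subset.antisymm fun x hx => (hf x hx).2 (by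
    have := hspan f hfτ0 h6 h7 _ (sub_mem_vectorSpan hx (h.subset hy₀.1))
    rw [map_sub, hfτ y₀ hy₀.1] at this
    linarith)
  rw [h8] at hdρ
  omega

/-! ### Lattice bases and orientation in codimension two -/

/-- The classes of `u` and `v` generate `Λ_σ / Λ_τ`: the coefficient of `v` is `N w`, and that of
`u` is the value of `M` on the remainder, which lies in `Λ_ρ`. Their independence is
`lattice_independent`. -/
theorem exists_lattice_decomposition {Λ : Submodule ℤ V} {τ ρ σ : Set V} {M N : V →ₗ[ℝ] ℝ}
    (hM : IsNormal Λ τ ρ M) (hN : IsNormal Λ ρ σ N) {u v : V} (hu : IsPrimitive Λ τ ρ u)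
    (hv : IsPrimitive Λ ρ σ v) {w : V} (hw : w ∈ latticeOf Λ σ) :
    ∃ k n : ℤ, N w = n ∧
      (vectorSpan ℝ τ).mkQ w =
        (k : ℝ) • (vectorSpan ℝ τ).mkQ u + (n : ℝ) • (vectorSpan ℝ τ).mkQ v := by
  rw [hM.isPrimitive_iff] at hu
  rw [hN.isPrimitive_iff] at hv
  obtain ⟨n, hn⟩ := hN.integral w hw
  have h1 : w - n • v ∈ latticeOf Λ σ := Submodule.sub_mem _ hw (Submodule.smul_mem _ n hv.1)
  have h2 : w - n • v ∈ latticeOf Λ ρ := ⟨h1.1, hN.mem _ h1.2 (by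
    rw [map_sub, map_zsmul, hv.2, hn, zsmul_one, sub_self])⟩
  obtain ⟨k, hk⟩ := hM.integral _ h2
  refine ⟨k, n, hn, ?_⟩
  rw [← map_smul, ← map_smul, ← map_add]
  refine (Submodule.Quotient.eq _).2 (hM.mem _ ?_ ?_)
  · have h3 := Submodule.sub_mem _ h2.2 (Submodule.smul_mem (vectorSpan ℝ ρ) (k : ℝ) hu.1.2)
    have : w - ((k : ℝ) • u + (n : ℝ) • v) = w - n • v - (k : ℝ) • u := by
      rw [Int.cast_smul_eq_zsmul ℝ n v]; abel
    rw [this]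
    exact h3
  · rw [← Int.cast_smul_eq_zsmul ℝ, map_sub] at hk
    rw [map_sub, map_add, map_smul M (k : ℝ), hu.2, smul_eq_mul, mul_one]
    linarith

theorem lattice_independent {Λ : Submodule ℤ V} {τ ρ σ : Set V} {M N : V →ₗ[ℝ] ℝ}
    (hM : IsNormal Λ τ ρ M) (hN : IsNormal Λ ρ σ N) {u v : V} (hu : IsPrimitive Λ τ ρ u)
    (hv : IsPrimitive Λ ρ σ v) {a b c d : ℝ}
    (h : a • (vectorSpan ℝ τ).mkQ u + b • (vectorSpan ℝ τ).mkQ v =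
      c • (vectorSpan ℝ τ).mkQ u + d • (vectorSpan ℝ τ).mkQ v) : a = c ∧ b = d := by
  rw [hM.isPrimitive_iff] at hu
  rw [hN.isPrimitive_iff] at hv
  simp only [← map_smul, ← map_add] at h
  have h1 := (Submodule.Quotient.eq _).1 h
  have h2 := hN.eq_zero _ (hM.face.vectorSpan_le h1)
  simp only [map_sub, map_add, map_smul, hN.eq_zero u hu.1.2, hv.2, smul_eq_mul] at h2
  have hbd : b = d := by linarith
  have h3 := hM.eq_zero _ h1
  simp only [map_sub, map_add, map_smul, hu.2, hbd, smul_eq_mul] at h3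
  exact ⟨by linarith, hbd⟩

/-- If `N u` were zero, `V_ρ'` would be contained in `V_ρ`, and `ρ'` would be a face of `ρ` of the
same dimension. This sign fixes the orientation in `wedge_add_wedge_mem`. -/
theorem normal_pos_of_ne [FiniteDimensional ℝ V] {Λ : Submodule ℤ V} {τ ρ ρ' σ : Set V}
    {M N : V →ₗ[ℝ] ℝ} (hM : IsNormal Λ τ ρ' M) (hN : IsNormal Λ ρ σ N) (hτρ : IsFace τ ρ)
    (hρσ : IsFace ρ' σ) (hd : polyDim ρ = polyDim ρ') (hne : ρ ≠ ρ') {u : V}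
    (hu : IsPrimitive Λ τ ρ' u) : 0 < N u := by
  have hu' := hM.isPrimitive_iff.1 hu
  refine lt_of_le_of_ne ?_ fun h0 => hne ?_
  · obtain ⟨-, ⟨t, ht, x, hx, y, hy, h⟩, -⟩ := hu
    rw [← map_smul] at h
    have h1 := hN.eq_zero _ (hτρ.vectorSpan_le ((Submodule.Quotient.eq _).1 h))
    rw [map_sub, map_smul, sub_eq_zero] at h1
    rw [h1]
    exact mul_nonneg ht (hN.nonneg x (hρσ.subset hx) y (hτρ.subset hy))
  · have hle : vectorSpan ℝ ρ' ≤ vectorSpan ℝ ρ := by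
      intro w hw
      have h1 := hM.mem (w - M w • u) (Submodule.sub_mem _ hw (Submodule.smul_mem _ _ hu'.1.2))
        (by rw [map_sub, map_smul, hu'.2, smul_eq_mul, mul_one, sub_self])
      have h2 := hN.mem u (hρσ.vectorSpan_le hu'.1.2) h0.symm
      have := Submodule.add_mem _ (hτρ.vectorSpan_le h1) (Submodule.smul_mem _ (M w) h2)
      rwa [sub_add_cancel] at this
    obtain ⟨y, hy⟩ := hτρ.1
    have hsub : ρ' ⊆ ρ := fun x hx => hN.face.mem_of_sub_mem (hρσ.subset hx) (hτρ.subset hy)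
      (hle (sub_mem_vectorSpan hx (hM.face.subset hy)))
    exact ((hρσ.of_subset hsub hN.face.subset).eq_of_polyDim_le hd.le).symm

/-- The two lattice bases at the two edges of a two-dimensional cone have opposite orientation. -/
theorem wedge_add_wedge_mem [FiniteDimensional ℝ V] {Λ : Submodule ℤ V} {τ ρ₁ ρ₂ σ : Set V}
    {M₁ N₁ M₂ N₂ : V →ₗ[ℝ] ℝ} (hM₁ : IsNormal Λ τ ρ₁ M₁) (hN₁ : IsNormal Λ ρ₁ σ N₁)
    (hM₂ : IsNormal Λ τ ρ₂ M₂) (hN₂ : IsNormal Λ ρ₂ σ N₂) (hd : polyDim ρ₁ = polyDim ρ₂)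
    (hne : ρ₁ ≠ ρ₂) {u₁ v₁ u₂ v₂ : V} (hu₁ : IsPrimitive Λ τ ρ₁ u₁) (hv₁ : IsPrimitive Λ ρ₁ σ v₁)
    (hu₂ : IsPrimitive Λ τ ρ₂ u₂) (hv₂ : IsPrimitive Λ ρ₂ σ v₂) {m : V →ₗ[ℝ] ℝ}
    (hm : ∀ v ∈ vectorSpan ℝ τ, m v = 0) :
    (m v₁ • u₁ - m u₁ • v₁) + (m v₂ • u₂ - m u₂ • v₂) ∈ vectorSpan ℝ τ := by
  have hu₁' := hM₁.isPrimitive_iff.1 hu₁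
  have hu₂' := hM₂.isPrimitive_iff.1 hu₂
  have hv₁' := hN₁.isPrimitive_iff.1 hv₁
  have hv₂' := hN₂.isPrimitive_iff.1 hv₂
  have hp := normal_pos_of_ne hM₂ hN₁ hM₁.face hN₂.face hd hne hu₂
  have hq := normal_pos_of_ne hM₁ hN₂ hM₂.face hN₁.face hd.symm hne.symm hu₁
  obtain ⟨a, p, hpN, h1⟩ := exists_lattice_decomposition hM₁ hN₁ hu₁ hv₁
    (latticeOf_mono hN₂.face hu₂'.1)
  obtain ⟨c, d, -, h2⟩ := exists_lattice_decomposition hM₁ hN₁ hu₁ hv₁ hv₂'.1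
  obtain ⟨a', q, hqN, h3⟩ := exists_lattice_decomposition hM₂ hN₂ hu₂ hv₂
    (latticeOf_mono hN₁.face hu₁'.1)
  obtain ⟨c', d', -, h4⟩ := exists_lattice_decomposition hM₂ hN₂ hu₂ hv₂ hv₁'.1
  obtain ⟨g, hg⟩ := exists_quotient_form hm
  have hmu := congrArg g h1
  have hmv := congrArg g h2
  simp only [map_add, map_smul, hg, smul_eq_mul] at hmu hmv
  rw [hpN] at hp
  rw [hqN] at hq
  have hp' : 0 < p := by exact_mod_cast hp
  have hq' : 0 < q := by exact_mod_cast hq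
  have e1 := lattice_independent hM₁ hN₁ hu₁ hv₁ (a := 1) (b := 0)
    (c := a' * a + q * c) (d := a' * p + q * d) (by
      rw [one_smul, zero_smul, add_zero]
      conv_lhs => rw [h3, h1, h2]
      module)
  have e2 := lattice_independent hM₁ hN₁ hu₁ hv₁ (a := 0) (b := 1)
    (c := c' * a + d' * c) (d := c' * p + d' * d) (by
      rw [one_smul, zero_smul, zero_add]
      conv_lhs => rw [h4, h1, h2]
      module)
  have i1 : 1 = a' * a + q * c := by exact_mod_cast e1.1
  have i2 : 0 = a' * p + q * d := by exact_mod_cast e1.2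
  have i3 : 0 = c' * a + d' * c := by exact_mod_cast e2.1
  have i4 : 1 = c' * p + d' * d := by exact_mod_cast e2.2
  -- The two changes of basis are inverse integer matrices, so their determinants are `±1`; the
  -- value `1` would give `q = -p`, although both are positive.
  have hdet : (a * d - p * c) * (a' * d' - q * c') = 1 := by
    linear_combination (-1 : ℤ) * i4 + (-(c' * p + d' * d)) * i1 + (c' * a + d' * c) * i2
  have hdet' : a * d - p * c = -1 := by
    rcases Int.isUnit_iff.1 (IsUnit.of_mul_eq_one _ hdet) with h | h
    · have : q = -p := by linear_combination (-q) * h - a * i2 + p * i1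
      omega
    · exact h
  have hdetR : (a : ℝ) * d - p * c = -1 := by exact_mod_cast hdet'
  rw [← Submodule.ker_mkQ (vectorSpan ℝ τ), LinearMap.mem_ker]
  simp only [map_add, map_sub, map_smul]
  rw [h1, h2, hmu, hmv]
  generalize (vectorSpan ℝ τ).mkQ u₁ = U
  generalize (vectorSpan ℝ τ).mkQ v₁ = W
  -- The contraction is alternating in the pair, so the second one is the first times the
  -- determinant.
  calc _ = (1 + ((a : ℝ) * d - p * c)) • (m v₁ • U - m u₁ • W) := by module
    _ = 0 := by rw [hdetR, add_neg_cancel, zero_smul]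

theorem sum_wedge_mem [FiniteDimensional ℝ V] {Λ : Submodule ℤ V}
    (hΛ : Submodule.span ℝ (Λ : Set V) = ⊤) {τ σ : Set V} (hσ : IsRationalPolyhedron Λ σ)
    (h : IsFace τ σ) (hd : polyDim τ + 2 = polyDim σ) (S : Finset (Set V))
    (hS : ∀ ρ, ρ ∈ S ↔ IsFace τ ρ ∧ IsFace ρ σ ∧ polyDim ρ + 1 = polyDim σ) {u v : Set V → V}
    (hu : ∀ ρ ∈ S, IsPrimitive Λ τ ρ (u ρ)) (hv : ∀ ρ ∈ S, IsPrimitive Λ ρ σ (v ρ))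
    {m : V →ₗ[ℝ] ℝ} (hm : ∀ v ∈ vectorSpan ℝ τ, m v = 0) :
    ∑ ρ ∈ S, (m (v ρ) • u ρ - m (u ρ) • v ρ) ∈ vectorSpan ℝ τ := by
  classical
  obtain ⟨ρ₁, ρ₂, hne, hρ⟩ := exists_two_ridges hσ h hd
  have hSe : S = {ρ₁, ρ₂} := by
    ext ρ
    rw [hS, hρ, Finset.mem_insert, Finset.mem_singleton]
  have hS₁ : ρ₁ ∈ S := by rw [hSe]; simp
  have hS₂ : ρ₂ ∈ S := by rw [hSe]; simp
  obtain ⟨h1, h2, h3⟩ := (hS ρ₁).1 hS₁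
  obtain ⟨h4, h5, h6⟩ := (hS ρ₂).1 hS₂
  obtain ⟨M₁, hM₁⟩ := exists_isNormal hΛ (h2.isRationalPolyhedron hσ) h1 (by omega)
  obtain ⟨N₁, hN₁⟩ := exists_isNormal hΛ hσ h2 h3
  obtain ⟨M₂, hM₂⟩ := exists_isNormal hΛ (h5.isRationalPolyhedron hσ) h4 (by omega)
  obtain ⟨N₂, hN₂⟩ := exists_isNormal hΛ hσ h5 h6
  rw [hSe, Finset.sum_pair hne]
  exact wedge_add_wedge_mem hM₁ hN₁ hM₂ hN₂ (by omega) hne (hu _ hS₁) (hv _ hS₁) (hu _ hS₂)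
    (hv _ hS₂) hm

/-! ### Divisors and products of rational functions are cycles -/

/-- `m` is the linear part of `φ` on `σ`. -/
def IsAffineOn (φ : V → ℝ) (σ : Set V) (m : V →ₗ[ℝ] ℝ) : Prop :=
  ∃ c : ℝ, ∀ x ∈ σ, φ x = m x + c

theorem IsAffineOn.mono {φ : V → ℝ} {τ σ : Set V} {m : V →ₗ[ℝ] ℝ} (h : IsAffineOn φ σ m)
    (hs : τ ⊆ σ) : IsAffineOn φ τ m := by
  obtain ⟨c, hc⟩ := h
  exact ⟨c, fun x hx => hc x (hs hx)⟩

theorem IsAffineOn.eq {φ : V → ℝ} {σ : Set V} {m m' : V →ₗ[ℝ] ℝ} (h : IsAffineOn φ σ m)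
    (h' : IsAffineOn φ σ m') {v : V} (hv : v ∈ vectorSpan ℝ σ) : m v = m' v := by
  obtain ⟨c, hc⟩ := h
  obtain ⟨c', hc'⟩ := h'
  rw [← sub_eq_zero, ← LinearMap.sub_apply]
  refine map_eq_zero_of_mem_vectorSpan (fun x hx y hy => ?_) hv
  rw [LinearMap.sub_apply, LinearMap.sub_apply]
  linarith [hc x hx, hc y hy, hc' x hx, hc' y hy]

theorem IsAffineOn.linPart {φ : V → ℝ} {σ : Set V} {m : V →ₗ[ℝ] ℝ} (h : IsAffineOn φ σ m) :
    IsAffineOn φ σ (linPart φ σ) := by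
  have hex : ∃ m : V →ₗ[ℝ] ℝ, ∃ c : ℝ, ∀ x ∈ σ, φ x = m x + c := ⟨m, h⟩
  rw [TropicalCycle.linPart, dif_pos hex]
  exact hex.choose_spec

theorem WeightedComplex.IsCycle.polyDim_le {Λ : Submodule ℤ V} {X : WeightedComplex V} (hX : IsCycle Λ X)
    {σ : Set V} (hσ : σ ∈ X.cells) : polyDim σ ≤ X.dim :=
  le_csSup (hX.finite.image _).bddAbove ⟨σ, hσ, rfl⟩

theorem WeightedComplex.IsCycle.finite_facetsAround {Λ : Submodule ℤ V} {X : WeightedComplex V}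
    (hX : IsCycle Λ X) (τ : Set V) : (X.facetsAround τ).Finite :=
  hX.finite.subset fun _ h => h.1.1

theorem exists_isNormal_of_ridge [FiniteDimensional ℝ V] {Λ : Submodule ℤ V}
    (hΛ : Submodule.span ℝ (Λ : Set V) = ⊤) {X : WeightedComplex V} (hX : IsCycle Λ X)
    {ρ σ : Set V} (hρ : ρ ∈ X.ridges) (hσ : σ ∈ X.facetsAround ρ) : ∃ N, IsNormal Λ ρ σ N :=
  exists_isNormal hΛ (hX.rational σ hσ.1.1) hσ.2 (hρ.2.trans hσ.1.2.symm)

theorem primSum_eq_sum {Λ : Submodule ℤ V} {X : WeightedComplex V} (hX : IsCycle Λ X)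
    (τ : Set V) : X.primSum Λ τ =
      ∑ σ ∈ (hX.finite_facetsAround τ).toFinset, X.weight σ • primVec Λ τ σ :=
  finsum_mem_eq_finite_toFinset_sum _ _

/-- By balancing, the sum of the primitive vectors lies in `V_ρ`, so any extension `n` of `φ_ρ` may
be used and distributed over the sum. As `m σ` and `n` agree on `V_ρ`, no term depends on the chosen
primitive vector. -/
theorem divisor_weight [FiniteDimensional ℝ V] {Λ : Submodule ℤ V}
    (hΛ : Submodule.span ℝ (Λ : Set V) = ⊤) {X : WeightedComplex V} (hX : IsCycle Λ X)
    {φ : V → ℝ} {ρ : Set V} (hρ : ρ ∈ X.ridges) {m : Set V → V →ₗ[ℝ] ℝ} {n : V →ₗ[ℝ] ℝ}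
    (hn : IsAffineOn φ ρ n) (hm : ∀ σ ∈ X.facetsAround ρ, IsAffineOn φ σ (m σ)) {v : Set V → V}
    (hv : ∀ σ ∈ X.facetsAround ρ, IsPrimitive Λ ρ σ (v σ)) :
    (divisor Λ φ X).weight ρ = ∑ σ ∈ (hX.finite_facetsAround ρ).toFinset,
      X.weight σ * (m σ (v σ) - n (v σ)) := by
  have h1 : (divisor Λ φ X).weight ρ =
      (∑ᶠ σ ∈ X.facetsAround ρ, X.weight σ * linPart φ σ (primVec Λ ρ σ))
        - linPart φ ρ (X.primSum Λ ρ) := if_pos hρ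
  rw [h1, finsum_mem_eq_finite_toFinset_sum _ (hX.finite_facetsAround ρ),
    hn.linPart.eq hn (hX.balanced ρ hρ), primSum_eq_sum hX, map_sum, ← Finset.sum_sub_distrib]
  refine Finset.sum_congr rfl fun σ hσ => ?_
  rw [Set.Finite.mem_toFinset] at hσ
  obtain ⟨N, hN⟩ := exists_isNormal_of_ridge hΛ hX hρ hσ
  have hp := hN.isPrimitive_primVec
  rw [(hm σ hσ).linPart.eq (hm σ hσ) (hN.isPrimitive_iff.1 hp).1.2, map_smul, smul_eq_mul,
    ← mul_sub]
  congr 1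
  have h2 := ((hm σ hσ).mono hσ.2.subset).eq hn (hN.sub_mem hp (hv σ hσ))
  rw [map_sub, map_sub] at h2
  linarith

theorem exists_ridge_of_not_facet [FiniteDimensional ℝ V] {Λ : Submodule ℤ V}
    {X : WeightedComplex V} (hX : IsCycle Λ X) {τ : Set V} (hτ : τ ∈ X.cells)
    (hτ' : τ ∉ X.facets) : ∃ ρ ∈ X.ridges, IsFace τ ρ := by
  obtain ⟨σ, hσ, h⟩ := hX.pure τ hτ
  obtain ⟨ρ, h1, h2, h3⟩ := exists_ridge_face (hX.rational σ hσ.1) h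
    (by rintro rfl; exact hτ' hσ)
  exact ⟨ρ, ⟨hX.face_mem σ hσ.1 ρ h2, h3.trans hσ.2⟩, h1⟩

theorem ridge_not_facet {X : WeightedComplex V} {ρ : Set V} (hρ : ρ ∈ X.ridges) :
    ρ ∉ X.facets := fun h => by
  have h1 := hρ.2
  have h2 := h.2
  omega

/-- The ridge is essential: the divisor of a zero-dimensional cycle is empty, and the empty complex
has dimension `0` by the convention for `sSup`. -/
theorem dim_divisor {Λ : Submodule ℤ V} {X : WeightedComplex V}
    (hX : IsCycle Λ X) (φ : V → ℝ) {ρ : Set V} (hρ : ρ ∈ X.ridges) :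
    (divisor Λ φ X).dim + 1 = X.dim := by
  have hρ' : ρ ∈ (divisor Λ φ X).cells := ⟨hρ.1, ridge_not_facet hρ⟩
  have h1 : polyDim ρ ≤ (divisor Λ φ X).dim :=
    le_csSup ((hX.finite.subset Set.sdiff_subset).image _).bddAbove ⟨ρ, hρ', rfl⟩
  have h2 : (divisor Λ φ X).dim ≤ X.dim - 1 := by
    refine csSup_le ⟨_, ρ, hρ', rfl⟩ ?_
    rintro _ ⟨τ, hτ, rfl⟩
    have h3 := hX.polyDim_le hτ.1
    have h4 : polyDim τ ≠ X.dim := fun h => hτ.2 ⟨hτ.1, h⟩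
    omega
  have := hρ.2
  omega

theorem facets_divisor [FiniteDimensional ℝ V] {Λ : Submodule ℤ V} {X : WeightedComplex V}
    (hX : IsCycle Λ X) (φ : V → ℝ) : (divisor Λ φ X).facets = X.ridges := by
  ext τ
  constructor
  · rintro ⟨h1, h2⟩
    obtain ⟨ρ, hρ, -⟩ := exists_ridge_of_not_facet hX h1.1 h1.2
    exact ⟨h1.1, by rw [h2, dim_divisor hX φ hρ]⟩
  · intro h
    refine ⟨⟨h.1, ridge_not_facet h⟩, ?_⟩
    have h1 := dim_divisor hX φ h
    have := h.2
    omega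

theorem exists_intCast_sum {ι : Type*} (s : Finset ι) {f : ι → ℝ}
    (h : ∀ i ∈ s, ∃ n : ℤ, f i = n) : ∃ n : ℤ, ∑ i ∈ s, f i = n := by
  choose! g hg using h
  exact ⟨∑ i ∈ s, g i, by rw [Int.cast_sum]; exact Finset.sum_congr rfl hg⟩

theorem divisor_weight_integral [FiniteDimensional ℝ V] {Λ : Submodule ℤ V}
    (hΛ : Submodule.span ℝ (Λ : Set V) = ⊤) {X : WeightedComplex V} (hX : IsCycle Λ X)
    {φ : V → ℝ} (hφ : IsRational Λ X φ) (ρ : Set V) :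
    ∃ n : ℤ, (divisor Λ φ X).weight ρ = n := by
  by_cases hρ : ρ ∈ X.ridges
  swap
  · exact ⟨0, (if_neg hρ).trans Int.cast_zero.symm⟩
  choose! m c hm hmc using hφ
  have hpv : ∀ σ ∈ X.facetsAround ρ, IsPrimitive Λ ρ σ (primVec Λ ρ σ) := fun σ hσ => by
    obtain ⟨N, hN⟩ := exists_isNormal_of_ridge hΛ hX hρ hσ
    exact hN.isPrimitive_primVec
  rw [divisor_weight hΛ hX hρ (n := m ρ) (m := m) (v := primVec Λ ρ) ⟨_, hmc ρ hρ.1⟩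
    (fun σ hσ => ⟨_, hmc σ hσ.1.1⟩) hpv]
  simp only [mul_sub]
  rw [Finset.sum_sub_distrib]
  obtain ⟨a, ha⟩ := exists_intCast_sum (hX.finite_facetsAround ρ).toFinset
    (f := fun σ => X.weight σ * m σ (primVec Λ ρ σ)) (fun σ hσ => by
      rw [Set.Finite.mem_toFinset] at hσ
      obtain ⟨N, hN⟩ := exists_isNormal_of_ridge hΛ hX hρ hσ
      obtain ⟨k, hk⟩ := hX.integral σ
      obtain ⟨l, hl⟩ := hm σ hσ.1.1 _ (hN.isPrimitive_iff.1 hN.isPrimitive_primVec).1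
      exact ⟨k * l, by rw [hk, hl, Int.cast_mul]⟩)
  -- `m ρ` is integral only on `Λ_ρ`, so it must be evaluated on the whole sum, which lies in `Λ_ρ`
  -- by balancing, and not term by term.
  obtain ⟨b, hb⟩ := hm ρ hρ.1 (X.primSum Λ ρ) ⟨by
    rw [primSum_eq_sum hX]
    refine Λ.sum_mem fun σ hσ => ?_
    rw [Set.Finite.mem_toFinset] at hσ
    obtain ⟨k, hk⟩ := hX.integral σ
    rw [hk, Int.cast_smul_eq_zsmul]
    exact Λ.smul_mem k (hpv σ hσ).1, hX.balanced ρ hρ⟩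
  refine ⟨a - b, ?_⟩
  rw [ha, Int.cast_sub, ← hb, primSum_eq_sum hX, map_sum]
  simp only [map_smul, smul_eq_mul]

/-- Double counting of `∑ ω(σ) T ρ σ` over ridges `ρ` and facets `σ` with `τ ≤ ρ < σ`. The part of
each `ρ` is its weighted primitive vector modulo `V_τ` (`key1`), while the part of each `σ` lies in
`V_τ` because its two ridges cancel (`key2`). -/
theorem divisor_balanced [FiniteDimensional ℝ V] {Λ : Submodule ℤ V}
    (hΛ : Submodule.span ℝ (Λ : Set V) = ⊤) {X : WeightedComplex V} (hX : IsCycle Λ X)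
    {φ : V → ℝ} (hφ : IsRational Λ X φ) {τ : Set V} (hτ : τ ∈ (divisor Λ φ X).ridges) :
    (divisor Λ φ X).primSum Λ τ ∈ vectorSpan ℝ τ := by
  classical
  have hτX : τ ∈ X.cells := hτ.1.1
  obtain ⟨ρ₀, hρ₀, -⟩ := exists_ridge_of_not_facet hX hτX hτ.1.2
  have hdim : polyDim τ + 2 = X.dim := by
    have h1 := dim_divisor hX φ hρ₀
    have h2 := hτ.2
    omega
  have haround : (divisor Λ φ X).facetsAround τ = {ρ | ρ ∈ X.ridges ∧ IsFace τ ρ} := by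
    unfold facetsAround
    rw [facets_divisor hX]
  have hfin : {ρ | ρ ∈ X.ridges ∧ IsFace τ ρ}.Finite := hX.finite.subset fun _ h => h.1.1
  choose! m c hm hmc using hφ
  have haff : ∀ σ ∈ X.cells, IsAffineOn φ σ (m σ) := fun σ hσ => ⟨_, hmc σ hσ⟩
  have hMex : ∀ ρ ∈ X.ridges, IsFace τ ρ → ∃ M, IsNormal Λ τ ρ M := fun ρ hρ h =>
    exists_isNormal hΛ (hX.rational ρ hρ.1) h (by have := hρ.2; omega)
  have hu : ∀ ρ ∈ X.ridges, IsFace τ ρ → IsPrimitive Λ τ ρ (primVec Λ τ ρ) := fun ρ hρ h => by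
    obtain ⟨M, hM⟩ := hMex ρ hρ h
    exact hM.isPrimitive_primVec
  have hv : ∀ ρ ∈ X.ridges, ∀ σ ∈ X.facetsAround ρ, IsPrimitive Λ ρ σ (primVec Λ ρ σ) :=
    fun ρ hρ σ hσ => by
      obtain ⟨N, hN⟩ := exists_isNormal_of_ridge hΛ hX hρ hσ
      exact hN.isPrimitive_primVec
  set T : Set V → Set V → V := fun ρ σ =>
    (m σ - m τ) (primVec Λ ρ σ) • primVec Λ τ ρ - (m σ - m τ) (primVec Λ τ ρ) • primVec Λ ρ σ
    with hT
  have key1 : ∀ ρ ∈ hfin.toFinset, (divisor Λ φ X).weight ρ • primVec Λ τ ρ -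
      ∑ σ ∈ (hX.finite_facetsAround ρ).toFinset, X.weight σ • T ρ σ ∈ vectorSpan ℝ τ := by
    intro ρ hρ
    rw [Set.Finite.mem_toFinset] at hρ
    obtain ⟨hρ, hτρ⟩ := hρ
    obtain ⟨M, hM⟩ := hMex ρ hρ hτρ
    have hup := hM.isPrimitive_iff.1 (hu ρ hρ hτρ)
    have hB := hX.balanced ρ hρ
    -- Modulo `V_τ`, balancing at `ρ` makes the sum of primitive vectors a multiple of `u_ρ`. The
    -- difference in `key1` is a multiple of this vector.
    have hmem : X.primSum Λ ρ - M (X.primSum Λ ρ) • primVec Λ τ ρ ∈ vectorSpan ℝ τ :=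
      hM.mem _ (Submodule.sub_mem _ hB (Submodule.smul_mem _ _ hup.1.2)) (by
        rw [map_sub, map_smul, hup.2, smul_eq_mul, mul_one, sub_self])
    have hval : (m ρ - m τ) (X.primSum Λ ρ) =
        M (X.primSum Λ ρ) * (m ρ - m τ) (primVec Λ τ ρ) := by
      have h1 := ((haff ρ hρ.1).mono hτρ.subset).eq (haff τ hτX) hmem
      rw [← sub_eq_zero, ← LinearMap.sub_apply, map_sub, map_smul, sub_eq_zero] at h1
      exact h1
    have hw : (divisor Λ φ X).weight ρ =
        (∑ σ ∈ (hX.finite_facetsAround ρ).toFinset,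
          X.weight σ * (m σ - m τ) (primVec Λ ρ σ)) - (m ρ - m τ) (X.primSum Λ ρ) := by
      rw [divisor_weight hΛ hX hρ (haff ρ hρ.1) (fun σ hσ => haff σ hσ.1.1) (hv ρ hρ),
        primSum_eq_sum hX, map_sum, ← Finset.sum_sub_distrib]
      refine Finset.sum_congr rfl fun σ _ => ?_
      simp only [LinearMap.sub_apply, map_smul, smul_eq_mul]
      ring
    have hs : ∑ σ ∈ (hX.finite_facetsAround ρ).toFinset, X.weight σ • T ρ σ =
        (∑ σ ∈ (hX.finite_facetsAround ρ).toFinset,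
          X.weight σ * (m σ - m τ) (primVec Λ ρ σ)) • primVec Λ τ ρ -
        (m ρ - m τ) (primVec Λ τ ρ) • X.primSum Λ ρ := by
      rw [primSum_eq_sum hX, Finset.sum_smul, Finset.smul_sum, ← Finset.sum_sub_distrib]
      refine Finset.sum_congr rfl fun σ hσ => ?_
      rw [Set.Finite.mem_toFinset] at hσ
      -- On `u_ρ ∈ V_ρ` all `m σ` agree with `m ρ`, so this coefficient can be taken out of the sum
      -- over `σ`.
      have h1 := ((haff σ hσ.1.1).mono hσ.2.subset).eq (haff ρ hρ.1) hup.1.2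
      simp only [hT, LinearMap.sub_apply, h1]
      module
    rw [hw, hs, hval]
    have := Submodule.smul_mem _ ((m ρ - m τ) (primVec Λ τ ρ)) hmem
    convert this using 1
    module
  have key2 : ∑ ρ ∈ hfin.toFinset, ∑ σ ∈ (hX.finite_facetsAround ρ).toFinset,
      X.weight σ • T ρ σ ∈ vectorSpan ℝ τ := by
    rw [Finset.sum_comm' (s' := fun σ => hfin.toFinset.filter fun ρ => IsFace ρ σ)
      (t' := (hX.finite_facetsAround τ).toFinset) (by
        intro ρ σ
        simp only [Set.Finite.mem_toFinset, Finset.mem_filter]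
        constructor
        · rintro ⟨⟨h1, h2⟩, h3, h4⟩
          exact ⟨⟨⟨h1, h2⟩, h4⟩, h3, h2.trans (hX.rational σ h3.1) h4⟩
        · rintro ⟨⟨⟨h1, h2⟩, h4⟩, h3, h5⟩
          exact ⟨⟨h1, h2⟩, h3, h4⟩)]
    refine Submodule.sum_mem _ fun σ hσ => ?_
    rw [Set.Finite.mem_toFinset] at hσ
    rw [← Finset.smul_sum]
    refine Submodule.smul_mem _ _ (sum_wedge_mem hΛ (hX.rational σ hσ.1.1) hσ.2
      (hdim.trans hσ.1.2.symm) _ (fun ρ => ?_) (fun ρ hρ => ?_) (fun ρ hρ => ?_)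
      fun v hv => ?_)
    · simp only [Set.Finite.mem_toFinset, Finset.mem_filter]
      constructor
      · rintro ⟨⟨h1, h2⟩, h3⟩
        exact ⟨h2, h3, h1.2.trans hσ.1.2.symm⟩
      · rintro ⟨h1, h2, h3⟩
        exact ⟨⟨⟨hX.face_mem σ hσ.1.1 ρ h2, h3.trans hσ.1.2⟩, h1⟩, h2⟩
    · simp only [Set.Finite.mem_toFinset, Finset.mem_filter] at hρ
      exact hu ρ hρ.1.1 hρ.1.2
    · simp only [Set.Finite.mem_toFinset, Finset.mem_filter] at hρ
      exact hv ρ hρ.1.1 σ ⟨hσ.1, hρ.2⟩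
    · rw [LinearMap.sub_apply, sub_eq_zero]
      exact ((haff σ hσ.1.1).mono hσ.2.subset).eq (haff τ hτX) hv
  have key3 := Submodule.add_mem _ (Submodule.sum_mem _ key1) key2
  rw [← Finset.sum_add_distrib] at key3
  simp only [sub_add_cancel] at key3
  unfold primSum
  rw [haround, finsum_mem_eq_finite_toFinset_sum _ hfin]
  exact key3

theorem isCycle_divisor [FiniteDimensional ℝ V] {Λ : Submodule ℤ V}
    (hΛ : Submodule.span ℝ (Λ : Set V) = ⊤) {X : WeightedComplex V} (hX : IsCycle Λ X)
    {φ : V → ℝ} (hφ : IsRational Λ X φ) : IsCycle Λ (divisor Λ φ X) where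
  finite := hX.finite.subset Set.sdiff_subset
  nonempty σ hσ := hX.nonempty σ hσ.1
  rational σ hσ := hX.rational σ hσ.1
  face_mem σ hσ τ h := by
    refine ⟨hX.face_mem σ hσ.1 τ h, fun hτ => hσ.2 ⟨hσ.1, ?_⟩⟩
    exact le_antisymm (hX.polyDim_le hσ.1) (hτ.2 ▸ h.polyDim_le)
  inter_face σ hσ ρ hρ := hX.inter_face σ hσ.1 ρ hρ.1
  pure τ hτ := by
    rw [facets_divisor hX]
    exact exists_ridge_of_not_facet hX hτ.1 hτ.2
  integral := divisor_weight_integral hΛ hX hφ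
  weight_eq_zero σ hσ := by
    rw [facets_divisor hX] at hσ
    exact if_neg hσ
  balanced τ hτ := divisor_balanced hΛ hX hφ hτ

theorem WeightedComplex.IsRational.mono {Λ : Submodule ℤ V} {X Y : WeightedComplex V} {φ : V → ℝ}
    (h : IsRational Λ X φ) (hs : Y.cells ⊆ X.cells) : IsRational Λ Y φ :=
  fun σ hσ => h σ (hs hσ)

theorem product_succ (Λ : Submodule ℤ V) {l : ℕ} (φ : Fin (l + 1) → V → ℝ)
    (X : WeightedComplex V) :
    product Λ φ X = divisor Λ (φ 0) (product Λ (fun i => φ i.succ) X) := by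
  unfold product
  rw [List.ofFn_succ, List.foldr_cons]

theorem product_zero (Λ : Submodule ℤ V) (φ : Fin 0 → V → ℝ) (X : WeightedComplex V) :
    product Λ φ X = X := by
  unfold product
  rw [List.ofFn_zero, List.foldr_nil]

theorem product_cells_subset (Λ : Submodule ℤ V) {l : ℕ} (φ : Fin l → V → ℝ)
    (X : WeightedComplex V) : (product Λ φ X).cells ⊆ X.cells := by
  induction l with
  | zero => rw [product_zero]
  | succ l ih =>
    rw [product_succ]
    exact Set.sdiff_subset.trans (ih _)

theorem isCycle_product [FiniteDimensional ℝ V] {Λ : Submodule ℤ V}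
    (hΛ : Submodule.span ℝ (Λ : Set V) = ⊤) {X : WeightedComplex V} (hX : IsCycle Λ X)
    {l : ℕ} (φ : Fin l → V → ℝ) (hφ : ∀ i, IsRational Λ X (φ i)) :
    IsCycle Λ (product Λ φ X) := by
  induction l with
  | zero => rwa [product_zero]
  | succ l ih =>
    rw [product_succ]
    exact isCycle_divisor hΛ (ih _ fun i => hφ i.succ)
      ((hφ 0).mono (product_cells_subset _ _ _))

/-! ### The star is a cycle -/

section

variable {Λ : Submodule ℤ V} {X : WeightedComplex V} {τ : Set V}

theorem WeightedComplex.IsCycle.exists_isRelInt (hX : IsCycle Λ X) (hτ : τ ∈ X.cells) :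
    ∃ y, IsRelInt τ y := (hX.rational τ hτ).exists_isRelInt (hX.nonempty τ hτ)

theorem WeightedComplex.IsCycle.face_trans (hX : IsCycle Λ X) {ρ σ : Set V} (hσ : σ ∈ X.cells)
    (h1 : IsFace τ ρ) (h2 : IsFace ρ σ) : IsFace τ σ := h1.trans (hX.rational σ hσ) h2

theorem WeightedComplex.IsCycle.starCone_inj (hX : IsCycle Λ X) {σ ρ : Set V} (hσ : σ ∈ X.cells)
    (hρ : ρ ∈ X.cells) (hτσ : IsFace τ σ) (hτρ : IsFace τ ρ)
    (h : starCone τ σ = starCone τ ρ) : σ = ρ := by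
  obtain ⟨h1, h2⟩ := hX.inter_face σ hσ ρ hρ
    (hτσ.1.mono (Set.subset_inter hτσ.subset hτρ.subset))
  exact starCone_injective (hX.exists_isRelInt (hX.face_mem σ hσ τ hτσ)) (hX.rational σ hσ)
    (hX.rational ρ hρ) hτσ hτρ h1 h2 h

theorem WeightedComplex.IsCycle.isRationalPolyhedron_starCone (hX : IsCycle Λ X) {σ : Set V}
    (hσ : σ ∈ X.cells) (hτσ : IsFace τ σ) :
    IsRationalPolyhedron (quotLattice Λ τ) (starCone τ σ) := by
  obtain ⟨y, hy⟩ := hX.exists_isRelInt (hX.face_mem σ hσ τ hτσ)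
  exact TropicalCycle.isRationalPolyhedron_starCone (hX.rational σ hσ) hτσ hy

theorem WeightedComplex.IsCycle.isFace_starCone_iff (hX : IsCycle Λ X) {ρ σ : Set V}
    (hρ : ρ ∈ X.cells) (hσ : σ ∈ X.cells) (hτρ : IsFace τ ρ) (hτσ : IsFace τ σ) :
    IsFace (starCone τ ρ) (starCone τ σ) ↔ IsFace ρ σ := by
  refine ⟨fun h => ?_, isFace_starCone hτρ⟩
  obtain ⟨ρ', h1, h2, h3⟩ := exists_eq_starCone_of_isFace (hX.rational σ hσ) hτσ
    (hX.isRationalPolyhedron_starCone hσ hτσ).convex h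
  rwa [hX.starCone_inj hρ (hX.face_mem σ hσ ρ' h2) hτρ h1 h3]

/-- By injectivity of `σ ↦ σ̄`, the sum defining the weight has the single term `ρ` if `ρ` is a
facet. Otherwise it is empty, and `ρ` has weight `0` by convention. -/
theorem star_weight (hX : IsCycle Λ X) {ρ : Set V} (hρ : ρ ∈ X.cells) (hτρ : IsFace τ ρ) :
    (star X τ).weight (starCone τ ρ) = X.weight ρ := by
  change ∑ᶠ σ ∈ {σ | σ ∈ X.facetsAround τ ∧ starCone τ σ = starCone τ ρ}, X.weight σ = _
  by_cases h : ρ ∈ X.facets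
  · have : {σ | σ ∈ X.facetsAround τ ∧ starCone τ σ = starCone τ ρ} = {ρ} := by
      ext σ
      constructor
      · rintro ⟨⟨h1, h2⟩, h3⟩
        exact hX.starCone_inj h1.1 hρ h2 hτρ h3
      · rintro rfl
        exact ⟨⟨h, hτρ⟩, rfl⟩
    rw [this, finsum_mem_singleton]
  · have : {σ | σ ∈ X.facetsAround τ ∧ starCone τ σ = starCone τ ρ} = ∅ := by
      ext σ
      constructor
      · rintro ⟨⟨h1, h2⟩, h3⟩
        exact h (hX.starCone_inj h1.1 hρ h2 hτρ h3 ▸ h1)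
      · exact fun h => h.elim
    rw [this, finsum_mem_empty, hX.weight_eq_zero ρ h]

theorem star_weight_of_notMem {c : Set (V ⧸ vectorSpan ℝ τ)} (hc : c ∉ (star X τ).cells) :
    (star X τ).weight c = 0 := by
  change ∑ᶠ σ ∈ {σ | σ ∈ X.facetsAround τ ∧ starCone τ σ = c}, X.weight σ = _
  have : {σ | σ ∈ X.facetsAround τ ∧ starCone τ σ = c} = ∅ := by
    ext σ
    constructor
    · rintro ⟨⟨h1, h2⟩, h3⟩
      exact hc ⟨σ, h1.1, h2, h3.symm⟩
    · exact fun h => h.elim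
  rw [this, finsum_mem_empty]

theorem star_finite (hX : IsCycle Λ X) : (star X τ).cells.Finite := by
  refine (hX.finite.image (starCone τ)).subset ?_
  rintro _ ⟨σ, hσ, -, rfl⟩
  exact ⟨σ, hσ, rfl⟩

theorem isFan_star : IsFan (star X τ) := by
  rintro _ ⟨σ, -, h, rfl⟩
  exact ⟨zero_mem_starCone h, fun t ht p hp => smul_mem_starCone ht hp⟩

theorem injOn_starCone (hX : IsCycle Λ X) {ρ : Set V} (hτρ : IsFace τ ρ) :
    Set.InjOn (starCone τ) (X.facetsAround ρ) := fun _ h1 _ h2 h =>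
  hX.starCone_inj h1.1.1 h2.1.1 (hX.face_trans h1.1.1 hτρ h1.2)
    (hX.face_trans h2.1.1 hτρ h2.2) h

variable [FiniteDimensional ℝ V]

theorem dim_star (hX : IsCycle Λ X) (hτ : τ ∈ X.cells) :
    (star X τ).dim + polyDim τ = X.dim := by
  obtain ⟨σ, hσ, h⟩ := hX.pure τ hτ
  have h1 : polyDim (starCone τ σ) ≤ (star X τ).dim :=
    le_csSup ((star_finite hX).image _).bddAbove ⟨_, ⟨σ, hσ.1, h, rfl⟩, rfl⟩
  have h2 : (star X τ).dim ≤ X.dim - polyDim τ := by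
    refine csSup_le ⟨_, _, ⟨σ, hσ.1, h, rfl⟩, rfl⟩ ?_
    rintro _ ⟨_, ⟨ρ, hρ, hτρ, rfl⟩, rfl⟩
    have := polyDim_starCone hτρ
    have := hX.polyDim_le hρ
    omega
  have := polyDim_starCone h
  have := hσ.2
  have := hX.polyDim_le hτ
  omega

theorem mem_facets_star (hX : IsCycle Λ X) {ρ : Set V} (hρ : ρ ∈ X.cells) (hτρ : IsFace τ ρ) :
    starCone τ ρ ∈ (star X τ).facets ↔ ρ ∈ X.facets := by
  have h1 := dim_star hX (hX.face_mem ρ hρ τ hτρ)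
  have h2 := polyDim_starCone hτρ
  constructor
  · exact fun h => ⟨hρ, by have := h.2; omega⟩
  · exact fun h => ⟨⟨ρ, hρ, hτρ, rfl⟩, by have := h.2; omega⟩

theorem mem_ridges_star (hX : IsCycle Λ X) {ρ : Set V} (hρ : ρ ∈ X.cells) (hτρ : IsFace τ ρ) :
    starCone τ ρ ∈ (star X τ).ridges ↔ ρ ∈ X.ridges := by
  have h1 := dim_star hX (hX.face_mem ρ hρ τ hτρ)
  have h2 := polyDim_starCone hτρ
  constructor
  · exact fun h => ⟨hρ, by have := h.2; omega⟩
  · exact fun h => ⟨⟨ρ, hρ, hτρ, rfl⟩, by have := h.2; omega⟩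

theorem facetsAround_star (hX : IsCycle Λ X) {ρ : Set V} (hρ : ρ ∈ X.cells)
    (hτρ : IsFace τ ρ) :
    (star X τ).facetsAround (starCone τ ρ) = starCone τ '' X.facetsAround ρ := by
  ext c
  constructor
  · rintro ⟨h1, h2⟩
    obtain ⟨σ, hσ, hτσ, rfl⟩ := h1.1
    exact ⟨σ, ⟨(mem_facets_star hX hσ hτσ).1 h1,
      (hX.isFace_starCone_iff hρ hσ hτρ hτσ).1 h2⟩, rfl⟩
  · rintro ⟨σ, ⟨h1, h2⟩, rfl⟩
    have hτσ := hX.face_trans h1.1 hτρ h2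
    exact ⟨(mem_facets_star hX h1.1 hτσ).2 h1, isFace_starCone hτρ h2⟩

/-- The chosen primitive vectors of the star differ from the images of those of `X` by elements of
`V_ρ̄`, so the balancing sum is the image of that of `X` modulo `V_ρ̄`. -/
theorem star_balanced (hΛ : Submodule.span ℝ (Λ : Set V) = ⊤) (hX : IsCycle Λ X) {ρ : Set V}
    (hρ : ρ ∈ X.ridges) (hτρ : IsFace τ ρ) :
    (star X τ).primSum (quotLattice Λ τ) (starCone τ ρ) ∈ vectorSpan ℝ (starCone τ ρ) := by
  unfold primSum
  rw [facetsAround_star hX hρ.1 hτρ, finsum_mem_image (injOn_starCone hX hτρ),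
    finsum_mem_eq_finite_toFinset_sum _ (hX.finite_facetsAround ρ)]
  have h1 : (vectorSpan ℝ τ).mkQ (X.primSum Λ ρ) ∈ vectorSpan ℝ (starCone τ ρ) :=
    (mkQ_mem_vectorSpan_starCone hτρ).2 (hX.balanced ρ hρ)
  have h2 : (∑ σ ∈ (hX.finite_facetsAround ρ).toFinset, X.weight σ •
      (primVec (quotLattice Λ τ) (starCone τ ρ) (starCone τ σ) -
        (vectorSpan ℝ τ).mkQ (primVec Λ ρ σ))) ∈ vectorSpan ℝ (starCone τ ρ) := by
    refine Submodule.sum_mem _ fun σ hσ => Submodule.smul_mem _ _ ?_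
    rw [Set.Finite.mem_toFinset] at hσ
    obtain ⟨N, hN⟩ := exists_isNormal_of_ridge hΛ hX hρ hσ
    have hτσ := hX.face_trans hσ.1.1 hτρ hσ.2
    obtain ⟨M, hM, -⟩ := hN.exists_quotient hτρ hτσ
    exact hM.sub_mem hM.isPrimitive_primVec
      (hN.isPrimitive_mkQ hτρ hτσ hN.isPrimitive_primVec)
  have h3 := Submodule.add_mem _ h2 h1
  rw [primSum_eq_sum hX, map_sum, ← Finset.sum_add_distrib] at h3
  convert h3 using 1
  refine Finset.sum_congr rfl fun σ hσ => ?_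
  rw [Set.Finite.mem_toFinset] at hσ
  rw [star_weight hX hσ.1.1 (hX.face_trans hσ.1.1 hτρ hσ.2), map_smul, ← smul_add,
    sub_add_cancel]

theorem isCycle_star (hΛ : Submodule.span ℝ (Λ : Set V) = ⊤) (hX : IsCycle Λ X) :
    IsCycle (quotLattice Λ τ) (star X τ) where
  finite := star_finite hX
  nonempty := by
    rintro _ ⟨σ, -, h, rfl⟩
    exact ⟨0, zero_mem_starCone h⟩
  rational := by
    rintro _ ⟨σ, hσ, h, rfl⟩
    exact hX.isRationalPolyhedron_starCone hσ h
  face_mem := by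
    rintro _ ⟨σ, hσ, h, rfl⟩ G hG
    obtain ⟨ρ, h1, h2, rfl⟩ := exists_eq_starCone_of_isFace (hX.rational σ hσ) h
      (hX.isRationalPolyhedron_starCone hσ h).convex hG
    exact ⟨ρ, hX.face_mem σ hσ ρ h2, h1, rfl⟩
  inter_face := by
    rintro _ ⟨σ, hσ, h, rfl⟩ _ ⟨ρ, hρ, h', rfl⟩ -
    obtain ⟨y, hy⟩ := hX.exists_isRelInt (hX.face_mem σ hσ τ h)
    have hsub := Set.subset_inter h.subset h'.subset
    obtain ⟨h1, h2⟩ := hX.inter_face σ hσ ρ hρ (h.1.mono hsub)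
    rw [← starCone_inter h.subset h'.subset (hX.rational σ hσ).convex
      (hX.rational ρ hρ).convex hy]
    have hi := h.of_subset hsub Set.inter_subset_left
    exact ⟨isFace_starCone hi h1, isFace_starCone hi h2⟩
  pure := by
    rintro _ ⟨σ, hσ, h, rfl⟩
    obtain ⟨ρ, hρ, h1⟩ := hX.pure σ hσ
    have h2 := hX.face_trans hρ.1 h h1
    exact ⟨_, (mem_facets_star hX hρ.1 h2).2 hρ, isFace_starCone h h1⟩
  integral := by
    intro c
    by_cases hc : c ∈ (star X τ).cells
    · obtain ⟨σ, hσ, h, rfl⟩ := hc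
      rw [star_weight hX hσ h]
      exact hX.integral σ
    · exact ⟨0, by rw [star_weight_of_notMem hc, Int.cast_zero]⟩
  weight_eq_zero := by
    intro c hcf
    by_cases hc : c ∈ (star X τ).cells
    · obtain ⟨σ, hσ, h, rfl⟩ := hc
      rw [star_weight hX hσ h]
      exact hX.weight_eq_zero σ fun hσf => hcf ((mem_facets_star hX hσ h).2 hσf)
    · exact star_weight_of_notMem hc
  balanced := by
    intro c hc
    obtain ⟨ρ, hρ, h, rfl⟩ := hc.1
    exact star_balanced hΛ hX ((mem_ridges_star hX hρ h).1 hc) h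

end

/-! ### Germs -/

/-- A germ is linear on the cones of the star. -/
theorem IsGerm.exists_form {X : WeightedComplex V} {φ : V → ℝ} {τ : Set V}
    {g : V ⧸ vectorSpan ℝ τ → ℝ} (hg : IsGerm X φ τ g) : ∃ ψ : V →ₗ[ℝ] ℝ,
      ∀ σ ∈ X.cells, IsFace τ σ → ∀ m, IsAffineOn φ σ m →
        ∃ M : V ⧸ vectorSpan ℝ τ →ₗ[ℝ] ℝ, (∀ v, M ((vectorSpan ℝ τ).mkQ v) = m v - ψ v) ∧
          IsAffineOn g (starCone τ σ) M := by
  obtain ⟨ψ, hψ, hg⟩ := hg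
  refine ⟨ψ.linear, fun σ hσ hτσ m hm => ?_⟩
  have hlin : ∀ x y, ψ.linear (x - y) = ψ x - ψ y := fun x y => ψ.linearMap_vsub x y
  obtain ⟨c, hc⟩ := hm
  obtain ⟨M, hM⟩ := exists_quotient_form (f := m - ψ.linear) (τ := τ) fun v hv =>
    map_eq_zero_of_mem_vectorSpan (fun x hx y hy => by
      rw [← sub_eq_zero, ← map_sub, LinearMap.sub_apply, hlin, map_sub]
      linarith [hψ x hx, hψ y hy, hc x (hτσ.subset hx), hc y (hτσ.subset hy)]) hv
  refine ⟨M, hM, 0, ?_⟩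
  rintro _ ⟨t, ht, x, hx, y, hy, rfl⟩
  rw [hg σ hσ hτσ x hx y hy t ht, map_smul, hM, LinearMap.sub_apply, hlin, map_sub, smul_eq_mul,
    add_zero]
  congr 1
  linarith [hψ y hy, hc x hx, hc y (hτσ.subset hy)]

/-- An arbitrary affine extension of `φ` from `τ` could destroy integrality. With an integral
section `s` of the projection, the form `v ↦ m_τ(v - s[v])` is integral on `Λ`, because `v - s[v] ∈
Λ_τ` for lattice vectors `v`. -/
theorem exists_germ [FiniteDimensional ℝ V] {Λ : Submodule ℤ V} (hΛ : IsLattice Λ)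
    {X : WeightedComplex V} (hX : IsCycle Λ X) {τ : Set V} (hτ : τ ∈ X.cells) {φ : V → ℝ}
    (hφ : IsRational Λ X φ) :
    ∃ g, IsGerm X φ τ g ∧ IsRational (quotLattice Λ τ) (star X τ) g := by
  classical
  obtain ⟨s, hs, hsΛ⟩ := exists_integral_section
    (isLattice_quotLattice hΛ (hX.rational τ hτ) (hX.nonempty τ hτ))
  obtain ⟨y₀, hy₀⟩ := hX.exists_isRelInt hτ
  choose! m c hm hmc using hφ
  set ψ : V →ₗ[ℝ] ℝ := m τ - m τ ∘ₗ s ∘ₗ (vectorSpan ℝ τ).mkQ with hψ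
  have hψv : ∀ v, ψ v = m τ (v - s ((vectorSpan ℝ τ).mkQ v)) := fun v => by
    rw [map_sub]; rfl
  have hψτ : ∀ v ∈ vectorSpan ℝ τ, ψ v = m τ v := fun v hv => by
    have h0 : (vectorSpan ℝ τ).mkQ v = 0 := (Submodule.Quotient.mk_eq_zero _).2 hv
    rw [hψv, h0, map_zero, sub_zero]
  set Ψ : V →ᵃ[ℝ] ℝ := ψ.toAffineMap + AffineMap.const ℝ V (φ y₀ - ψ y₀)
  have hΨ : ∀ x, Ψ x = ψ x + (φ y₀ - ψ y₀) := fun x => rfl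
  have hΨτ : ∀ y ∈ τ, φ y = Ψ y := fun y hy => by
    have h1 := hψτ _ (sub_mem_vectorSpan hy hy₀.1)
    rw [map_sub, map_sub] at h1
    rw [hΨ]
    linarith [hmc τ hτ y hy, hmc τ hτ y₀ hy₀.1]
  have hMex : ∀ σ, ∃ M : V ⧸ vectorSpan ℝ τ →ₗ[ℝ] ℝ, σ ∈ X.cells → IsFace τ σ →
      ∀ v, M ((vectorSpan ℝ τ).mkQ v) = m σ v - ψ v := by
    intro σ
    by_cases h : σ ∈ X.cells ∧ IsFace τ σ
    · obtain ⟨M, hM⟩ := exists_quotient_form (f := m σ - ψ) (τ := τ) fun v hv => by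
        rw [LinearMap.sub_apply, hψτ v hv, sub_eq_zero]
        exact IsAffineOn.eq ⟨c σ, fun x hx => hmc σ h.1 x (h.2.subset hx)⟩ ⟨c τ, hmc τ hτ⟩ hv
      exact ⟨M, fun _ _ => hM⟩
    · exact ⟨0, fun h1 h2 => absurd ⟨h1, h2⟩ h⟩
  choose M hM using hMex
  have hval : ∀ σ ∈ X.cells, IsFace τ σ → ∀ (t : ℝ), ∀ x ∈ σ, ∀ y ∈ τ,
      M σ (t • (vectorSpan ℝ τ).mkQ (x - y)) = t * (φ x - Ψ x) := by
    intro σ hσ h t x hx y hy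
    rw [map_smul, hM σ hσ h, smul_eq_mul, map_sub, map_sub, hΨ]
    congr 1
    have := hΨτ y hy
    rw [hΨ] at this
    linarith [hmc σ hσ x hx, hmc σ hσ y (h.subset hy)]
  -- The forms glue: a point in two cones lies in the cone of `σ' ∩ σ`, where both forms are given
  -- by the values of `φ - Ψ`.
  set g : V ⧸ vectorSpan ℝ τ → ℝ := fun p =>
    if h : ∃ σ, σ ∈ X.cells ∧ IsFace τ σ ∧ p ∈ starCone τ σ then M h.choose p else 0
  have hg : ∀ σ ∈ X.cells, IsFace τ σ → ∀ p ∈ starCone τ σ, g p = M σ p := by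
    intro σ hσ hτσ p hp
    have hex : ∃ σ, σ ∈ X.cells ∧ IsFace τ σ ∧ p ∈ starCone τ σ := ⟨σ, hσ, hτσ, hp⟩
    have hgp : g p = M hex.choose p := dif_pos hex
    rw [hgp]
    obtain ⟨h1, h2, h3⟩ := hex.choose_spec
    generalize hex.choose = σ' at h1 h2 h3 ⊢
    have h4 : p ∈ starCone τ (σ' ∩ σ) := by
      rw [starCone_inter h2.subset hτσ.subset (hX.rational _ h1).convex
        (hX.rational σ hσ).convex hy₀]
      exact ⟨h3, hp⟩
    obtain ⟨t, ht, x, hx, y, hy, hpe⟩ := h4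
    rw [hpe, hval _ h1 h2 t x hx.1 y hy, hval σ hσ hτσ t x hx.2 y hy]
  refine ⟨g, ⟨Ψ, hΨτ, fun σ hσ hτσ x hx y hy t ht => ?_⟩, ?_⟩
  · rw [hg σ hσ hτσ _ ⟨t, ht, x, hx, y, hy, rfl⟩, hval σ hσ hτσ t x hx y hy]
  · rintro _ ⟨σ, hσ, hτσ, rfl⟩
    refine ⟨M σ, 0, fun p hp => ?_, fun p hp => by rw [hg σ hσ hτσ p hp, add_zero]⟩
    obtain ⟨v, hv, rfl⟩ := (mem_latticeOf_quotLattice hτσ).1 hp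
    obtain ⟨a, ha⟩ := hm σ hσ v hv
    obtain ⟨b, hb⟩ := hm τ hτ (v - s ((vectorSpan ℝ τ).mkQ v))
      ⟨Λ.sub_mem hv.1 (hsΛ _ ⟨v, hv.1, rfl⟩), (Submodule.Quotient.eq _).1 (hs _).symm⟩
    exact ⟨a - b, by rw [hM σ hσ hτσ, ha, hψv, hb, Int.cast_sub]⟩

/-! ### Stars of divisors and products -/

/-- In the formula of `divisor_weight` the facets and primitive vectors correspond, and all linear
parts are shifted by the same form `ψ`, which cancels in each difference. -/
theorem divisor_weight_star [FiniteDimensional ℝ V] {Λ : Submodule ℤ V} (hΛ : IsLattice Λ)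
    {X : WeightedComplex V} (hX : IsCycle Λ X) {τ ρ : Set V} (hρ : ρ ∈ X.ridges)
    (hτρ : IsFace τ ρ) {φ : V → ℝ} (hφ : IsRational Λ X φ) {g : V ⧸ vectorSpan ℝ τ → ℝ}
    (hg : IsGerm X φ τ g) :
    (divisor (quotLattice Λ τ) g (star X τ)).weight (starCone τ ρ) =
      (divisor Λ φ X).weight ρ := by
  classical
  have hτ := hX.face_mem ρ hρ.1 τ hτρ
  have hΛt := hΛ.span_eq_top
  have hΛ' := (isLattice_quotLattice hΛ (hX.rational τ hτ) (hX.nonempty τ hτ)).span_eq_top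
  obtain ⟨ψ, hψ⟩ := hg.exists_form
  choose! m c hm hmc using hφ
  have haff : ∀ σ ∈ X.cells, IsAffineOn φ σ (m σ) := fun σ hσ => ⟨_, hmc σ hσ⟩
  have hM := fun σ hσ hτσ => hψ σ hσ hτσ (m σ) (haff σ hσ)
  choose! M hMv hMaff using hM
  have hcell : ∀ C ∈ (star X τ).cells, ∃ σ, σ ∈ X.cells ∧ IsFace τ σ ∧ C = starCone τ σ :=
    fun C hC => hC
  -- `S` inverts `σ ↦ σ̄`, so that data indexed by polyhedra of `X` can be indexed by cones of the
  -- star.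
  choose! S hS hτS hCS using hcell
  have hSσ : ∀ σ ∈ X.cells, IsFace τ σ → S (starCone τ σ) = σ := fun σ hσ h => by
    have hC : starCone τ σ ∈ (star X τ).cells := ⟨σ, hσ, h, rfl⟩
    exact (hX.starCone_inj hσ (hS _ hC) h (hτS _ hC) (hCS _ hC)).symm
  have hpv : ∀ σ ∈ X.facetsAround ρ, IsPrimitive Λ ρ σ (primVec Λ ρ σ) := fun σ hσ => by
    obtain ⟨N, hN⟩ := exists_isNormal_of_ridge hΛt hX hρ hσ
    exact hN.isPrimitive_primVec
  have haround := facetsAround_star hX hρ.1 hτρ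
  have hX' := isCycle_star (τ := τ) hΛt hX
  have hτσ : ∀ σ ∈ X.facetsAround ρ, IsFace τ σ := fun σ hσ =>
    hX.face_trans hσ.1.1 hτρ hσ.2
  rw [divisor_weight hΛt hX hρ (haff ρ hρ.1) (fun σ hσ => haff σ hσ.1.1) hpv,
    divisor_weight hΛ' hX' ((mem_ridges_star hX hρ.1 hτρ).2 hρ) (hMaff ρ hρ.1 hτρ)
      (m := fun C => M (S C)) (v := fun C => (vectorSpan ℝ τ).mkQ (primVec Λ ρ (S C)))]
  · have himage : (hX'.finite_facetsAround (starCone τ ρ)).toFinset =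
        (hX.finite_facetsAround ρ).toFinset.image (starCone τ) := by
      ext C
      rw [Set.Finite.mem_toFinset, haround, Finset.mem_image]
      simp only [Set.Finite.mem_toFinset, Set.mem_image]
    rw [himage, Finset.sum_image (by
      intro σ hσ σ' hσ' h
      rw [Finset.mem_coe, Set.Finite.mem_toFinset] at hσ hσ'
      exact injOn_starCone hX hτρ hσ hσ' h)]
    refine Finset.sum_congr rfl fun σ hσ => ?_
    rw [Set.Finite.mem_toFinset] at hσ
    rw [star_weight hX hσ.1.1 (hτσ σ hσ), hSσ σ hσ.1.1 (hτσ σ hσ),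
      hMv σ hσ.1.1 (hτσ σ hσ), hMv ρ hρ.1 hτρ, sub_sub_sub_cancel_right]
  · rw [haround]
    rintro _ ⟨σ, hσ, rfl⟩
    rw [hSσ σ hσ.1.1 (hτσ σ hσ)]
    exact hMaff σ hσ.1.1 (hτσ σ hσ)
  · rw [haround]
    rintro _ ⟨σ, hσ, rfl⟩
    obtain ⟨N, hN⟩ := exists_isNormal_of_ridge hΛt hX hρ hσ
    rw [hSσ σ hσ.1.1 (hτσ σ hσ)]
    exact hN.isPrimitive_mkQ hτρ (hτσ σ hσ) (hpv σ hσ)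

theorem star_divisor [FiniteDimensional ℝ V] {Λ : Submodule ℤ V} (hΛ : IsLattice Λ)
    {X : WeightedComplex V} (hX : IsCycle Λ X) {τ : Set V} {φ : V → ℝ}
    (hφ : IsRational Λ X φ) {g : V ⧸ vectorSpan ℝ τ → ℝ} (hg : IsGerm X φ τ g) :
    star (divisor Λ φ X) τ = divisor (quotLattice Λ τ) g (star X τ) := by
  have hcells : (star (divisor Λ φ X) τ).cells =
      (divisor (quotLattice Λ τ) g (star X τ)).cells := by
    ext C
    constructor
    · rintro ⟨σ, hσ, h, rfl⟩
      exact ⟨⟨σ, hσ.1, h, rfl⟩, fun hc => hσ.2 ((mem_facets_star hX hσ.1 h).1 hc)⟩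
    · rintro ⟨⟨σ, hσ, h, rfl⟩, hc⟩
      exact ⟨σ, ⟨hσ, fun hf => hc ((mem_facets_star hX hσ h).2 hf)⟩, h, rfl⟩
  refine WeightedComplex.ext hcells (funext fun C => ?_)
  have hX' := isCycle_divisor hΛ.span_eq_top hX hφ
  by_cases hC : C ∈ (star (divisor Λ φ X) τ).cells
  · obtain ⟨ρ, hρ, h, rfl⟩ := hC
    rw [star_weight hX' hρ h]
    by_cases hr : ρ ∈ X.ridges
    · exact (divisor_weight_star hΛ hX hr h hφ hg).symm
    · have h1 : starCone τ ρ ∉ (star X τ).ridges := fun hc =>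
        hr ((mem_ridges_star hX hρ.1 h).1 hc)
      exact (if_neg hr).trans (if_neg h1).symm
  · rw [star_weight_of_notMem hC]
    refine (if_neg fun hr => hC ?_).symm
    rw [hcells]
    exact ⟨hr.1, ridge_not_facet hr⟩

theorem IsGerm.mono {X Y : WeightedComplex V} {φ : V → ℝ} {τ : Set V}
    {g : V ⧸ vectorSpan ℝ τ → ℝ} (h : IsGerm X φ τ g) (hs : Y.cells ⊆ X.cells) :
    IsGerm Y φ τ g := by
  obtain ⟨ψ, h1, h2⟩ := h
  exact ⟨ψ, h1, fun σ hσ => h2 σ (hs hσ)⟩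

theorem star_product [FiniteDimensional ℝ V] {Λ : Submodule ℤ V} (hΛ : IsLattice Λ)
    {X : WeightedComplex V} (hX : IsCycle Λ X) {τ : Set V} {l : ℕ} (φ : Fin l → V → ℝ)
    (hφ : ∀ i, IsRational Λ X (φ i)) (g : Fin l → V ⧸ vectorSpan ℝ τ → ℝ)
    (hg : ∀ i, IsGerm X (φ i) τ (g i)) :
    star (product Λ φ X) τ = product (quotLattice Λ τ) g (star X τ) := by
  induction l with
  | zero => rw [product_zero, product_zero]
  | succ l ih =>
    have hs := product_cells_subset Λ (fun i => φ (Fin.succ i)) X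
    rw [product_succ, product_succ,
      ← ih (fun i => φ i.succ) (fun i => hφ _) (fun i => g i.succ) (fun i => hg _)]
    exact star_divisor hΛ (isCycle_product hΛ.span_eq_top hX _ fun i => hφ _)
      ((hφ 0).mono hs) ((hg 0).mono hs)

/-- `{0}` is the cone of `τ` itself. If `τ` is not in the complex, then no polyhedron of it has `τ`
as a face, and both weights are `0`. -/
theorem star_weight_zero {Λ : Submodule ℤ V} {X : WeightedComplex V} (hX : IsCycle Λ X)
    {τ : Set V} (hne : τ.Nonempty) : (star X τ).weight {0} = X.weight τ := by
  rw [← starCone_self hne]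
  by_cases hτ : τ ∈ X.cells
  · exact star_weight hX hτ (isFace_refl hne)
  · rw [star_weight_of_notMem, hX.weight_eq_zero τ fun h => hτ h.1]
    rintro ⟨σ, hσ, h, -⟩
    exact hτ (hX.face_mem σ hσ τ h)

/-! ### Iterated stars and germs -/

/-- Base points in `σ̄` die in `V / V_σ`, which gives one inclusion. The other follows by writing `x
- y` as `(x - y₀) - (y - y₀)` with `y₀ ∈ τ`. -/
theorem image_starCone_starCone {τ σ ρ : Set V} (hτσ : IsFace τ σ)
    (e : ((V ⧸ vectorSpan ℝ τ) ⧸ vectorSpan ℝ (starCone τ σ)) ≃ₗ[ℝ] (V ⧸ vectorSpan ℝ σ))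
    (he : ∀ v : V, e ((vectorSpan ℝ (starCone τ σ)).mkQ ((vectorSpan ℝ τ).mkQ v)) =
      (vectorSpan ℝ σ).mkQ v) :
    e '' starCone (starCone τ σ) (starCone τ ρ) = starCone σ ρ := by
  ext p
  constructor
  · rintro ⟨_, ⟨t, ht, _, ⟨s, hs, x, hx, y, hy, rfl⟩, _, ⟨s', -, x', hx', y', hy', rfl⟩, rfl⟩, rfl⟩
    refine ⟨t * s, mul_nonneg ht hs, x, hx, y, hτσ.subset hy, ?_⟩
    have h0 : (vectorSpan ℝ σ).mkQ (x' - y') = 0 :=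
      (Submodule.Quotient.mk_eq_zero _).2 (sub_mem_vectorSpan hx' (hτσ.subset hy'))
    rw [map_smul, ← map_smul _ s, ← map_smul _ s', ← map_sub, he, map_sub, map_smul, map_smul, h0,
      smul_zero, sub_zero, smul_smul]
  · rintro ⟨t, ht, x, hx, y, hy, rfl⟩
    obtain ⟨y₀, hy₀⟩ := hτσ.1
    refine ⟨_, ⟨t, ht, _, mkQ_sub_mem_starCone hx hy₀, _, mkQ_sub_mem_starCone hy hy₀, rfl⟩, ?_⟩
    rw [map_smul, ← map_sub, he, sub_sub_sub_cancel_right]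

theorem map_star_star {Λ : Submodule ℤ V} [FiniteDimensional ℝ V]
    (hΛ : Submodule.span ℝ (Λ : Set V) = ⊤) {X : WeightedComplex V} (hX : IsCycle Λ X)
    {τ σ : Set V} (hσ : σ ∈ X.cells) (hτσ : IsFace τ σ)
    (e : ((V ⧸ vectorSpan ℝ τ) ⧸ vectorSpan ℝ (starCone τ σ)) ≃ₗ[ℝ] (V ⧸ vectorSpan ℝ σ))
    (he : ∀ v : V, e ((vectorSpan ℝ (starCone τ σ)).mkQ ((vectorSpan ℝ τ).mkQ v)) =
      (vectorSpan ℝ σ).mkQ v) :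
    (star (star X τ) (starCone τ σ)).map e = star X σ := by
  have hX' := isCycle_star (τ := τ) hΛ hX
  have hcells : ((star (star X τ) (starCone τ σ)).map e).cells = (star X σ).cells := by
    ext C
    constructor
    · rintro ⟨_, ⟨_, ⟨ρ, hρ, hτρ, rfl⟩, h, rfl⟩, rfl⟩
      have h' := (hX.isFace_starCone_iff hσ hρ hτσ hτρ).1 h
      exact ⟨ρ, hρ, h', image_starCone_starCone hτσ e he⟩
    · rintro ⟨ρ, hρ, h, rfl⟩
      have hτρ := hX.face_trans hρ hτσ h
      exact ⟨_, ⟨_, ⟨ρ, hρ, hτρ, rfl⟩, isFace_starCone hτσ h, rfl⟩,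
        image_starCone_starCone hτσ e he⟩
  refine WeightedComplex.ext hcells (funext fun C => ?_)
  change (star (star X τ) (starCone τ σ)).weight (e ⁻¹' C) = _
  by_cases hC : C ∈ (star X σ).cells
  · obtain ⟨ρ, hρ, h, rfl⟩ := hC
    have hτρ := hX.face_trans hρ hτσ h
    rw [star_weight hX hρ h, ← image_starCone_starCone hτσ e he,
      Set.preimage_image_eq _ e.injective,
      star_weight hX' ⟨ρ, hρ, hτρ, rfl⟩ (isFace_starCone hτσ h), star_weight hX hρ hτρ]
  · rw [star_weight_of_notMem hC, star_weight_of_notMem]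
    intro h
    rw [← hcells] at hC
    exact hC ⟨_, h, Set.image_preimage_eq _ e.surjective⟩

/-- The germ of a germ is the germ, up to a linear function. -/
theorem germ_germ {X : WeightedComplex V} {τ σ : Set V} (hσ : σ ∈ X.cells) (hτσ : IsFace τ σ)
    (hface : ∀ ρ ∈ X.cells, IsFace σ ρ → IsFace τ ρ)
    (e : ((V ⧸ vectorSpan ℝ τ) ⧸ vectorSpan ℝ (starCone τ σ)) ≃ₗ[ℝ] (V ⧸ vectorSpan ℝ σ))
    (he : ∀ v : V, e ((vectorSpan ℝ (starCone τ σ)).mkQ ((vectorSpan ℝ τ).mkQ v)) =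
      (vectorSpan ℝ σ).mkQ v) {φ : V → ℝ} {g : V ⧸ vectorSpan ℝ τ → ℝ}
    {h : (V ⧸ vectorSpan ℝ τ) ⧸ vectorSpan ℝ (starCone τ σ) → ℝ} {k : V ⧸ vectorSpan ℝ σ → ℝ}
    (hg : IsGerm X φ τ g) (hh : IsGerm (star X τ) g (starCone τ σ) h) (hk : IsGerm X φ σ k) :
    ∃ m : (V ⧸ vectorSpan ℝ σ) →ₗ[ℝ] ℝ,
      ∀ c ∈ (star X σ).cells, ∀ p ∈ c, h (e.symm p) = k p + m p := by
  obtain ⟨α, -, hg⟩ := hg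
  obtain ⟨β, hβ, hh⟩ := hh
  obtain ⟨γ, hγ, hk⟩ := hk
  obtain ⟨y₀, hy₀⟩ := hτσ.1
  have hgx : ∀ ρ ∈ X.cells, IsFace τ ρ → ∀ x ∈ ρ,
      g ((vectorSpan ℝ τ).mkQ (x - y₀)) = φ x - α x := fun ρ hρ hτρ x hx => by
    have := hg ρ hρ hτρ x hx y₀ hy₀ 1 zero_le_one
    rwa [one_smul, one_mul] at this
  have hαl : ∀ x y, α.linear (x - y) = α x - α y := fun x y => α.linearMap_vsub x y
  have hβl : ∀ x y, β.linear (x - y) = β x - β y := fun x y => β.linearMap_vsub x y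
  have hγl : ∀ x y, γ.linear (x - y) = γ x - γ y := fun x y => γ.linearMap_vsub x y
  -- `A` is the linear part of the affine function `γ - α - β([· - y₀])`, which compares the
  -- corrections in the three germs. It vanishes on `σ`, so `A` descends to `V / V_σ` as the
  -- required linear function.
  set A : V →ₗ[ℝ] ℝ := γ.linear - α.linear - β.linear ∘ₗ (vectorSpan ℝ τ).mkQ with hA
  have hAl : ∀ x y, A (x - y) = (γ x - α x - β ((vectorSpan ℝ τ).mkQ (x - y₀))) -
      (γ y - α y - β ((vectorSpan ℝ τ).mkQ (y - y₀))) := fun x y => by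
    have h1 : (vectorSpan ℝ τ).mkQ (x - y) =
        (vectorSpan ℝ τ).mkQ (x - y₀) - (vectorSpan ℝ τ).mkQ (y - y₀) := by
      rw [← map_sub, sub_sub_sub_cancel_right]
    rw [hA, LinearMap.sub_apply, LinearMap.sub_apply, LinearMap.comp_apply, h1, hαl, hβl, hγl]
    ring
  have hzero : ∀ y ∈ σ, γ y - α y - β ((vectorSpan ℝ τ).mkQ (y - y₀)) = 0 := fun y hy => by
    rw [← hβ _ (mkQ_sub_mem_starCone hy hy₀), hgx σ hσ hτσ y hy, hγ y hy, sub_self]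
  obtain ⟨m, hm⟩ := exists_quotient_form (f := A) (τ := σ) fun v hv =>
    map_eq_zero_of_mem_vectorSpan (fun x hx y hy => by
      rw [← sub_eq_zero, ← map_sub, hAl, hzero x hx, hzero y hy, sub_zero]) hv
  refine ⟨m, ?_⟩
  rintro _ ⟨ρ, hρ, hσρ, rfl⟩ _ ⟨t, ht, x, hx, y, hy, rfl⟩
  have hτρ := hface ρ hρ hσρ
  have hsymm : e.symm (t • (vectorSpan ℝ σ).mkQ (x - y)) =
      t • (vectorSpan ℝ (starCone τ σ)).mkQ
        ((vectorSpan ℝ τ).mkQ (x - y₀) - (vectorSpan ℝ τ).mkQ (y - y₀)) := by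
    rw [LinearEquiv.symm_apply_eq, map_smul, ← map_sub, he, sub_sub_sub_cancel_right]
  rw [hsymm, hh _ ⟨ρ, hρ, hτρ, rfl⟩ (isFace_starCone hτσ hσρ) _ (mkQ_sub_mem_starCone hx hy₀) _
    (mkQ_sub_mem_starCone hy hy₀) t ht, hk ρ hρ hσρ x hx y hy t ht, map_smul, hm, hAl,
    hzero y hy, hgx ρ hρ hτρ x hx, smul_eq_mul]
  ring

/-- The canonical isomorphism between the iterated quotient and the quotient. -/
theorem exists_quotientEquiv {τ σ : Set V} (hτσ : IsFace τ σ) :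
    ∃ e : ((V ⧸ vectorSpan ℝ τ) ⧸ vectorSpan ℝ (starCone τ σ)) ≃ₗ[ℝ] (V ⧸ vectorSpan ℝ σ),
      ∀ v : V, e ((vectorSpan ℝ (starCone τ σ)).mkQ ((vectorSpan ℝ τ).mkQ v)) =
        (vectorSpan ℝ σ).mkQ v :=
  ⟨(Submodule.quotEquivOfEq _ _ (vectorSpan_starCone hτσ)).trans
    (Submodule.quotientQuotientEquivQuotient _ _ hτσ.vectorSpan_le), fun _ => rfl⟩

theorem map_quotLattice_quotLattice {Λ : Submodule ℤ V} {τ σ : Set V}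
    (e : ((V ⧸ vectorSpan ℝ τ) ⧸ vectorSpan ℝ (starCone τ σ)) ≃ₗ[ℝ] (V ⧸ vectorSpan ℝ σ))
    (he : ∀ v : V, e ((vectorSpan ℝ (starCone τ σ)).mkQ ((vectorSpan ℝ τ).mkQ v)) =
      (vectorSpan ℝ σ).mkQ v) :
    (quotLattice (quotLattice Λ τ) (starCone τ σ)).map (e.toLinearMap.restrictScalars ℤ) =
      quotLattice Λ σ := by
  ext p
  constructor
  · rintro ⟨_, ⟨_, ⟨v, hv, rfl⟩, rfl⟩, rfl⟩
    exact ⟨v, hv, (he v).symm⟩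
  · rintro ⟨v, hv, rfl⟩
    exact ⟨_, ⟨_, ⟨v, hv, rfl⟩, rfl⟩, he v⟩

end TropicalCycle

open TropicalCycle WeightedComplex in
theorem mainTheorem2 {V : Type*} [AddCommGroup V] [Module ℝ V] [FiniteDimensional ℝ V]
    (Λ : Submodule ℤ V) (hΛ : IsLattice Λ)
    (X : WeightedComplex V) (hX : IsCycle Λ X)
    (τ σ : Set V) (hτ : τ ∈ X.cells) (hσ : σ ∈ X.cells) (hτσ : IsFace τ σ) :
    -- the star is a fan cycle in `V / V_τ`, germs exist as rational functions on it,
    -- and products of rational functions with `X` are cycles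
    (IsLattice (quotLattice Λ τ) ∧ IsCycle (quotLattice Λ τ) (star X τ) ∧ IsFan (star X τ)) ∧
    (∀ φ : V → ℝ, IsRational Λ X φ →
      ∃ g, IsGerm X φ τ g ∧ IsRational (quotLattice Λ τ) (star X τ) g) ∧
    (∀ (l : ℕ) (φ : Fin l → V → ℝ), (∀ i, IsRational Λ X (φ i)) →
      IsCycle Λ (product Λ φ X)) ∧
    -- (a), (b): under the canonical isomorphism `(V / V_τ) / V_σ̄ ≅ V / V_σ`
    (∃ e : ((V ⧸ vectorSpan ℝ τ) ⧸ vectorSpan ℝ (starCone τ σ)) ≃ₗ[ℝ] (V ⧸ vectorSpan ℝ σ),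
      (∀ v : V, e ((vectorSpan ℝ (starCone τ σ)).mkQ ((vectorSpan ℝ τ).mkQ v)) =
        (vectorSpan ℝ σ).mkQ v) ∧
      (quotLattice (quotLattice Λ τ) (starCone τ σ)).map
        (e.toLinearMap.restrictScalars ℤ) = quotLattice Λ σ ∧
      (star (star X τ) (starCone τ σ)).map e = star X σ ∧
      (∀ φ : V → ℝ, IsRational Λ X φ → ∀ g h k,
        IsGerm X φ τ g → IsGerm (star X τ) g (starCone τ σ) h → IsGerm X φ σ k →
        ∃ m : (V ⧸ vectorSpan ℝ σ) →ₗ[ℝ] ℝ,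
          ∀ c ∈ (star X σ).cells, ∀ p ∈ c, h (e.symm p) = k p + m p)) ∧
    -- (c)
    (∀ φ : V → ℝ, IsRational Λ X φ → ∀ g, IsGerm X φ τ g →
      star (divisor Λ φ X) τ = divisor (quotLattice Λ τ) g (star X τ)) ∧
    -- (d), (e)
    (∀ (l : ℕ) (φ : Fin l → V → ℝ), (∀ i, IsRational Λ X (φ i)) →
      ∀ g : Fin l → V ⧸ vectorSpan ℝ τ → ℝ, (∀ i, IsGerm X (φ i) τ (g i)) →
        star (product Λ φ X) τ = product (quotLattice Λ τ) g (star X τ) ∧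
        (l + polyDim τ = X.dim →
          (product Λ φ X).weight τ = (product (quotLattice Λ τ) g (star X τ)).weight {0})) := by
  have hΛt := hΛ.span_eq_top
  obtain ⟨e, he⟩ := exists_quotientEquiv hτσ
  refine ⟨⟨isLattice_quotLattice hΛ (hX.rational τ hτ) (hX.nonempty τ hτ), isCycle_star hΛt hX,
    isFan_star⟩, fun φ hφ => exists_germ hΛ hX hτ hφ, fun l φ hφ => isCycle_product hΛt hX φ hφ,
    ⟨e, he, map_quotLattice_quotLattice e he, map_star_star hΛt hX hσ hτσ e he,
      fun φ _ g h k hg hh hk => germ_germ hσ hτσ (fun ρ hρ h => hX.face_trans hρ hτσ h) e he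
        hg hh hk⟩,
    fun φ hφ g hg => star_divisor hΛ hX hφ hg, fun l φ hφ g hg => ?_⟩
  have hstar := star_product hΛ hX φ hφ g hg
  refine ⟨hstar, fun _ => ?_⟩
  rw [← hstar, star_weight_zero (isCycle_product hΛt hX φ hφ) (hX.nonempty τ hτ)]
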